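/- For each $n\in\mathbb N$ and $k\in\{0,1\}^n$ let $f_k:\{0,1\}^n\to\{0,1\}^n$ be a function, and let $\mathcal F=\{f_k\}$ be the resulting keyed family. **Conventions.** A function $\varepsilon:\mathbb N\to\mathbb R$ is *negligible* if for every positive polynomial $p$ one has $\varepsilon(n)<1/p(n)$ for all sufficiently large $n$. A *quantum polynomial time (QPT) oracle algorithm* is a family of quantum circuits $(C_n)_n$ over Hadamard, Toffoli, $\pi/4$-phase and oracle gates (an oracle call has unit cost), acting on qubits initialized to $|0\rangle$ and followed by a measurement in the computational basis, such that a single classical program on input $1^n$ produces $C_n$ in time polynomial in $n$. The quantum oracle of a function $g$ is the unitary $|x\rangle|y\rangle\mapsto|x\rangle|y\oplus g(x)\rangle$. **Hypothesis.** $\mathcal F$ is a family of quantum-secure pseudorandom functions: for every QPT distinguisher $\mathcal D$ with quantum oracle access to a function there is a negligible $\varepsilon$ such that for all $n$ $$\Bigl|\Pr_{k\leftarrow\{0,1\}^n}[\mathcal D^{f_k}(1^n)=1]-\Pr_{f}[\mathcal D^{f}(1^n)=1]\Bigr|\le\varepsilon(n),$$ where $k$ is uniform in $\{0,1\}^n$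 and $f$ is uniform among all functions $\{0,1\}^n\to\{0,1\}^n$. **The scheme $\Pi[\mathcal F]$.** The key $k$ is uniform in $\{0,1\}^n$. A message $m\in\{0,1\}^n$ is encrypted with uniform randomness $r\in\{0,1\}^n$ as $\mathrm{Enc}_k(m;r)=(r,f_k(r)\oplus m)$, and $\mathrm{Dec}_k(r,c)=c\oplus f_k(r)$. **The game.** A key $k$ is generated and a bit $b\in\{0,1\}$ is drawn uniformly. First the adversary $\mathcal A$, on input $1^n$, has quantum oracle access to $\mathrm{Enc}_k$ and $\mathrm{Dec}_k$, that is, to $$|m\rangle|c\rangle\mapsto|m\rangle|c\oplus\mathrm{Enc}_k(m;r)\rangle,\qquad |c\rangle|s\rangle\mapsto|c\rangle|s\oplus\mathrm{Dec}_k(c)\rangle,$$ where each encryption query uses fresh uniform randomness $r$, the same for all branches of the superposition. Then $\mathcal A$ outputs classical messages $m_0,m_1\in\{0,1\}^n$ and receives the challenge $\mathrm{Enc}_k(m_b;r^*)$ with fresh uniform $r^*$. Afterwards $\mathcal A$, which keeps its quantum state, has quantum oracle access to $\mathrm{Enc}_k$ only. Finally $\mathcal A$ outputs a bit $b'$; it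 wins if $b'=b$. **Conclusion.** $\Pi[\mathcal F]$ is IND-QCCA1-secure: for every QPT adversary $\mathcal A$ there is a negligible function $\varepsilon$ such that for all $n$ $$\Pr[\mathcal A\text{ wins}]\le \tfrac12+\varepsilon(n).$$ -/

import Mathlib

open scoped BigOperators

noncomputable section

namespace QCrypto

/-! ### Bit strings and negligible functions -/

/-- Bit strings of length `n`. -/
abbrev BitString (n : ℕ) : Type := Fin n → Bool

/-- Bitwise exclusive or. -/
def bxor {n : ℕ} (a b : BitString n) : BitString n := fun i => Bool.xor (a i) (b i)

/-- `ε` is negligible: it is eventually below `1 / p` for every positive polynomial `p`. -/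
def Negligible (ε : ℕ → ℝ) : Prop :=
  ∀ p : Polynomial ℝ, (∀ n : ℕ, 0 < p.eval (n : ℝ)) →
    ∃ N : ℕ, ∀ n : ℕ, N < n → ε n < 1 / p.eval (n : ℝ)

/-! ### Quantum memory

The quantum memory consists of named arrays of qubits; the qubit `(a, i)` is the `i`-th qubit of the
array `a`. A state is a finite superposition of computational basis states. The memory starts in the
all-zero state, and a computation touches only finitely many qubits. -/

/-- Addresses of qubits: name of an array and index in that array. -/
abbrev Qubit : Type := ℕ × ℕ

/-- Computational basis states. -/
abbrev Ket : Type := Qubit → Bool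

/-- (Not necessarily normalized) states: finite linear combinations of basis states. -/
abbrev State : Type := Ket →₀ ℂ

/-- The all-zero basis state. -/
def zeroState : State := Finsupp.single (fun _ => false) 1

/-- The squared norm of a state. -/
def normSq (ψ : State) : ℝ := ψ.sum fun _ a => ‖a‖ ^ 2

/-- The contents of the first `n` qubits of the array `a` in a basis state. -/
def Ket.read (z : Ket) (a n : ℕ) : BitString n := fun i => z (a, i)

/-- Exclusive or of the string `v` into the first `n` qubits of the array `a`. -/
def Ket.xorInto {n : ℕ} (z : Ket) (a : ℕ) (v : BitString n) : Ket := fun u =>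
  if h : u.1 = a ∧ u.2 < n then Bool.xor (z u) (v ⟨u.2, h.2⟩) else z u

/-- The reversible evaluation `|x⟩|y⟩ ↦ |x⟩|y ⊕ f x⟩`, where `x` stands in the array `a` and `y` in
the array `b`. If the two arrays coincide, nothing happens. -/
def oracleMap {p q : ℕ} (f : BitString p → BitString q) (a b : ℕ) (z : Ket) : Ket :=
  if a = b then z else z.xorInto b (f (z.read a p))

/-! ### Circuits with oracle gates -/

/-- Gates over the universal set Hadamard, `π/4`-phase shift and Toffoli, together with oracle
gates, whose labels come from `Q`. -/
inductive Gate (Q : Type) : Type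
  | hadamard (q : Qubit)
  | phase (q : Qubit)
  | toffoli (c₁ c₂ t : Qubit)
  | query (o : Q)

/-- The action of a gate on basis states, where the oracle gate `o` maps `|z⟩` to `|O o z⟩`. A
Toffoli gate whose target is also a control does nothing; if the two controls coincide, it is a
controlled NOT gate. -/
def Gate.onKet {Q : Type} (O : Q → Ket → Ket) : Gate Q → Ket → State
  | .hadamard q, z =>
      Finsupp.single (Function.update z q false) (1 / (Real.sqrt 2 : ℂ)) +
        Finsupp.single (Function.update z q true)
          (if z q then -(1 / (Real.sqrt 2 : ℂ)) else 1 / (Real.sqrt 2 : ℂ))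
  | .phase q, z =>
      Finsupp.single z (if z q then Complex.exp (((Real.pi / 4 : ℝ) : ℂ) * Complex.I) else 1)
  | .toffoli c₁ c₂ t, z =>
      Finsupp.single
        (if t = c₁ ∨ t = c₂ then z else Function.update z t (Bool.xor (z t) (z c₁ && z c₂))) 1
  | .query o, z => Finsupp.single (O o z) 1

/-- The action of a gate on states. -/
def Gate.apply {Q : Type} (O : Q → Ket → Ket) (g : Gate Q) : State →ₗ[ℂ] State :=
  Finsupp.linearCombination ℂ (g.onKet O)

/-- The expected value of `κ` at the final state of a circuit with randomized oracles: at each step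
a coin `r` is drawn uniformly and independently from `R`, and the oracle gates act as `O r`.
Elementary gates ignore the coin. -/
def expectRun {Q R : Type} [Fintype R] (O : R → Q → Ket → Ket) (κ : State → ℝ) :
    List (Gate Q) → State → ℝ
  | [], ψ => κ ψ
  | g :: gs, ψ => 𝔼 r : R, expectRun O κ gs (g.apply (O r) ψ)

/-! ### Uniform polynomial time

Circuits are generated by a classical control: an imperative program with natural number variables
and arrays (random access, unit-cost addition and truncated subtraction). Running the program emits
the gates of the circuit one after the other. -/

/-- Control programs. Variables, classical arrays and qubit arrays have fixed names in the program;
indices into arrays are values of variables. -/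
inductive Prog (Q : Type) : Type
  /-- do nothing -/
  | skip
  /-- `x := c` -/
  | const (x c : ℕ)
  /-- `x := y + z` -/
  | add (x y z : ℕ)
  /-- `x := y - z`, truncated at zero -/
  | sub (x y z : ℕ)
  /-- `x := a[y]` -/
  | load (x a y : ℕ)
  /-- `a[x] := y` -/
  | store (a x y : ℕ)
  /-- a Hadamard gate on qubit `a[x]` -/
  | hadamard (a x : ℕ)
  /-- a phase gate on qubit `a[x]` -/
  | phase (a x : ℕ)
  /-- a Toffoli gate with controls `a[x]`, `b[y]` and target `c[z]` -/
  | toffoli (a x b y c z : ℕ)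
  /-- an oracle gate -/
  | query (o : Q)
  /-- sequential composition -/
  | seq (P P' : Prog Q)
  /-- if `x = 0` then `P` else `P'` -/
  | ifZero (x : ℕ) (P P' : Prog Q)
  /-- while `x ≠ 0` do `P` -/
  | while (x : ℕ) (P : Prog Q)

/-- Contents of the classical memory. -/
structure Mem : Type where
  var : ℕ → ℕ
  arr : ℕ → ℕ → ℕ

/-- Assignment to a variable. -/
def Mem.set (μ : Mem) (x v : ℕ) : Mem := { μ with var := Function.update μ.var x v }

/-- Assignment to an array entry. -/
def Mem.setArr (μ : Mem) (a i v : ℕ) : Mem :=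
  { μ with arr := Function.update μ.arr a (Function.update (μ.arr a) i v) }

/-- The initial memory on input `1ⁿ`: variable `0` holds `n`, all else is zero. -/
def Mem.init (n : ℕ) : Mem := ⟨fun x => if x = 0 then n else 0, fun _ _ => 0⟩

/-- `Exec P μ C μ' t`: started in memory `μ`, the program `P` halts after `t` steps in memory `μ'`,
having emitted the list of gates `C`. -/
inductive Exec {Q : Type} : Prog Q → Mem → List (Gate Q) → Mem → ℕ → Prop
  | skip (μ : Mem) : Exec .skip μ [] μ 1
  | const (μ : Mem) (x c : ℕ) : Exec (.const x c) μ [] (μ.set x c) 1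
  | add (μ : Mem) (x y z : ℕ) : Exec (.add x y z) μ [] (μ.set x (μ.var y + μ.var z)) 1
  | sub (μ : Mem) (x y z : ℕ) : Exec (.sub x y z) μ [] (μ.set x (μ.var y - μ.var z)) 1
  | load (μ : Mem) (x a y : ℕ) : Exec (.load x a y) μ [] (μ.set x (μ.arr a (μ.var y))) 1
  | store (μ : Mem) (a x y : ℕ) :
      Exec (.store a x y) μ [] (μ.setArr a (μ.var x) (μ.var y)) 1
  | hadamard (μ : Mem) (a x : ℕ) : Exec (.hadamard a x) μ [.hadamard (a, μ.var x)] μ 1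
  | phase (μ : Mem) (a x : ℕ) : Exec (.phase a x) μ [.phase (a, μ.var x)] μ 1
  | toffoli (μ : Mem) (a x b y c z : ℕ) :
      Exec (.toffoli a x b y c z) μ [.toffoli (a, μ.var x) (b, μ.var y) (c, μ.var z)] μ 1
  | query (μ : Mem) (o : Q) : Exec (.query o) μ [.query o] μ 1
  | seq {P P' : Prog Q} {μ μ' μ'' : Mem} {C C' : List (Gate Q)} {t t' : ℕ} :
      Exec P μ C μ' t → Exec P' μ' C' μ'' t' → Exec (.seq P P') μ (C ++ C') μ'' (t + t')
  | ifZero_zero {x : ℕ} {P P' : Prog Q} {μ μ' : Mem} {C : List (Gate Q)} {t : ℕ} :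
      μ.var x = 0 → Exec P μ C μ' t → Exec (.ifZero x P P') μ C μ' (t + 1)
  | ifZero_pos {x : ℕ} {P P' : Prog Q} {μ μ' : Mem} {C : List (Gate Q)} {t : ℕ} :
      μ.var x ≠ 0 → Exec P' μ C μ' t → Exec (.ifZero x P P') μ C μ' (t + 1)
  | while_zero {x : ℕ} {P : Prog Q} {μ : Mem} :
      μ.var x = 0 → Exec (.while x P) μ [] μ 1
  | while_pos {x : ℕ} {P : Prog Q} {μ μ' μ'' : Mem} {C C' : List (Gate Q)} {t t' : ℕ} :
      μ.var x ≠ 0 → Exec P μ C μ' t → Exec (.while x P) μ' C' μ'' t' →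
        Exec (.while x P) μ (C ++ C') μ'' (t + t' + 1)

/-- A quantum polynomial time oracle algorithm: a family of circuits that is generated, on input
`1ⁿ`, by one program in time polynomial in `n`. -/
def IsQPT {Q : Type} (C : ℕ → List (Gate Q)) : Prop :=
  ∃ (P : Prog Q) (p : Polynomial ℕ), ∀ n, ∃ (μ : Mem) (t : ℕ),
    Exec P (Mem.init n) (C n) μ t ∧ t ≤ p.eval n

/-- A quantum polynomial time oracle algorithm in two phases, with different oracles in the two
phases. The second phase continues with the classical memory of the first. -/
def IsQPTTwoPhase {Q₁ Q₂ : Type} (C₁ : ℕ → List (Gate Q₁)) (C₂ : ℕ → List (Gate Q₂)) : Prop :=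
  ∃ (P₁ : Prog Q₁) (P₂ : Prog Q₂) (p : Polynomial ℕ), ∀ n, ∃ (μ₁ μ₂ : Mem) (t₁ t₂ : ℕ),
    Exec P₁ (Mem.init n) (C₁ n) μ₁ t₁ ∧ Exec P₂ μ₁ (C₂ n) μ₂ t₂ ∧ t₁ + t₂ ≤ p.eval n

/-- The qubit in which algorithms leave their output bit. -/
def outQubit : Qubit := (3, 0)

/-- The (unnormalized) probability that measuring the output qubit yields `b`. -/
def outProb (b : Bool) (ψ : State) : ℝ := normSq (ψ.filter fun z => z outQubit = b)

/-! ### Quantum-secure pseudorandom functions -/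

/-- Query to a function: input array `x`, output array `y`. -/
inductive FunQuery : Type
  | eval (x y : ℕ)

/-- Quantum oracle for the function `f`. -/
def funOracle {p q : ℕ} (f : BitString p → BitString q) : FunQuery → Ket → Ket
  | .eval x y => oracleMap f x y

/-- The probability that the circuit `C` with quantum oracle `f` outputs `1`. -/
def acceptProb {p q : ℕ} (C : List (Gate FunQuery)) (f : BitString p → BitString q) : ℝ :=
  expectRun (fun _ : Unit => funOracle f) (outProb true) C zeroState

/-- Quantum-secure pseudorandom functions: no quantum polynomial time distinguisher with quantum
oracle access tells `F n k`, for uniform `k`, from a uniformly random function. -/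
def IsQPRF {keyLen inLen outLen : ℕ → ℕ}
    (F : ∀ n, BitString (keyLen n) → BitString (inLen n) → BitString (outLen n)) : Prop :=
  ∀ D : ℕ → List (Gate FunQuery), IsQPT D →
    ∃ ε : ℕ → ℝ, Negligible ε ∧ ∀ n,
      |(𝔼 k : BitString (keyLen n), acceptProb (D n) (F n k)) -
        𝔼 f : BitString (inLen n) → BitString (outLen n), acceptProb (D n) f| ≤ ε n

/-! ### Symmetric-key encryption and non-adaptive quantum chosen-ciphertext attacks -/

/-- Symmetric-key encryption schemes, with randomized encryption and deterministic decryption. The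
last argument of `enc` is the randomness, which is uniform. -/
structure EncryptionScheme : Type where
  keyLen : ℕ → ℕ
  msgLen : ℕ → ℕ
  ctLen : ℕ → ℕ
  coinLen : ℕ → ℕ
  keyGen : ∀ n, PMF (BitString (keyLen n))
  enc : ∀ n, BitString (keyLen n) → BitString (msgLen n) → BitString (coinLen n) →
    BitString (ctLen n)
  dec : ∀ n, BitString (keyLen n) → BitString (ctLen n) → BitString (msgLen n)
  correct : ∀ n k m r, dec n k (enc n k m r) = m

/-- Queries before the challenge: encryption (message array `m`, ciphertext array `c`) and
decryption (ciphertext array `c`, message array `m`). -/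
inductive EncDecQuery : Type
  | enc (m c : ℕ)
  | dec (c m : ℕ)

/-- Queries after the challenge: encryption only. -/
inductive EncQuery : Type
  | enc (m c : ℕ)

/-- The quantum oracles for `Enc_k(· ; r)` and `Dec_k`. -/
def encDecOracle (S : EncryptionScheme) (n : ℕ) (k : BitString (S.keyLen n))
    (r : BitString (S.coinLen n)) : EncDecQuery → Ket → Ket
  | .enc m c => oracleMap (fun x => S.enc n k x r) m c
  | .dec c m => oracleMap (S.dec n k) c m

/-- The quantum oracle for `Enc_k(· ; r)`. -/
def encOracle (S : EncryptionScheme) (n : ℕ) (k : BitString (S.keyLen n))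
    (r : BitString (S.coinLen n)) : EncQuery → Ket → Ket
  | .enc m c => oracleMap (fun x => S.enc n k x r) m c

/-- The probability that the adversary, consisting of the circuit `C₁` before and the circuit `C₂`
after the challenge, outputs the challenge bit `b`, when the key is `k`. At the end of the first
phase the messages `m₀` and `m₁` are obtained by measuring the qubit arrays `0` and `1`; the
challenge ciphertext is handed over in the qubit array `2`, by exclusive or. Fresh uniform
randomness is used in each encryption query and in the challenge. -/
def guessProb (S : EncryptionScheme) (n : ℕ) (C₁ : List (Gate EncDecQuery))
    (C₂ : List (Gate EncQuery)) (k : BitString (S.keyLen n)) (b : Bool) : ℝ :=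
  expectRun (encDecOracle S n k)
    (fun ψ => ∑ m₀ : BitString (S.msgLen n), ∑ m₁ : BitString (S.msgLen n),
      𝔼 r : BitString (S.coinLen n),
        expectRun (encOracle S n k) (outProb b) C₂
          ((ψ.filter fun z => z.read 0 (S.msgLen n) = m₀ ∧ z.read 1 (S.msgLen n) = m₁).mapDomain
            fun z => z.xorInto 2 (S.enc n k (if b then m₁ else m₀) r)))
    C₁ zeroState

/-- The probability that the adversary wins the indistinguishability game. -/
def winProb (S : EncryptionScheme) (n : ℕ) (C₁ : List (Gate EncDecQuery))
    (C₂ : List (Gate EncQuery)) : ℝ :=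
  ∑ k : BitString (S.keyLen n), (S.keyGen n k).toReal * 𝔼 b : Bool, guessProb S n C₁ C₂ k b

/-- Indistinguishability of encryptions under non-adaptive quantum chosen-ciphertext attacks. -/
def IsINDQCCA1 (S : EncryptionScheme) : Prop :=
  ∀ (C₁ : ℕ → List (Gate EncDecQuery)) (C₂ : ℕ → List (Gate EncQuery)), IsQPTTwoPhase C₁ C₂ →
    ∃ ε : ℕ → ℝ, Negligible ε ∧ ∀ n, winProb S n (C₁ n) (C₂ n) ≤ 1 / 2 + ε n

/-- The encryption scheme of a keyed function family: the key is uniform, the encryption of `m` with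
randomness `r` is `(r, f_k(r) ⊕ m)`, the decryption of `(r, c)` is `c ⊕ f_k(r)`. -/
def prfScheme (F : ∀ n, BitString n → BitString n → BitString n) : EncryptionScheme where
  keyLen n := n
  msgLen n := n
  ctLen n := n + n
  coinLen n := n
  keyGen n := PMF.uniformOfFintype (BitString n)
  enc n k m r := Fin.append r (bxor (F n k r) m)
  dec n k c := bxor (fun i => c (Fin.natAdd n i)) (F n k fun i => c (Fin.castAdd n i))
  correct n k m r := by
    funext i
    simp only [bxor, Fin.append_left, Fin.append_right]
    cases F n k r i <;> cases m i <;> rfl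

end QCrypto

end

noncomputable section

namespace QCrypto

/-! ### The squared norm -/

/-! The proof is a reduction. A distinguisher plays the game against its own oracle with a random
challenge bit and accepts if the adversary wins. With oracle `f_k` it accepts with exactly the
winning probability, so pseudorandomness reduces the claim to a uniformly random `f`
(`expect_gameProb_le`).

For random `f`, let `r` be the challenge coin. Resampling the value at `r` (`expect_update`) turns
the game into one with oracle `Function.update f r s` and challenge mask `s`, where `f`, `r`, `s`
are independent. Replacing the updated oracle by `f` costs little in each phase. Before the
challenge, a basis state of a query involves `f` at a single point, so the updates at different `r`
alter disjoint sets of basis states, and on average over `r` only a `2⁻ⁿ` fraction of the mass is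
affected (`expect_expectRun_le`). After the challenge there is no decryption, and `f` is read at `r`
only if a fresh coin equals `r` (`challengeValue_update_le`). The mask `s` is then a one-time pad,
and the adversary wins with probability exactly one half (`expect_challengeValue`).

The hybrid argument uses no norms of operators. It needs only that outcome probabilities are bounded
by the squared norm and obey a triangle inequality with a free weight `t` (`IsEffect`). The choice
`t = 2^(-n/2)` gives an error of order `2^(-n/2)` per gate.

The distinguisher is a measurement-free circuit with a deterministic oracle, so coins and
intermediate measurements must be simulated. Coins are Hadamard gates on fresh qubits, and measured
messages are copied into auxiliary arrays. If no later gate alters such a qubit, its branches do not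
interfere (`IsDecohered`), which is the principle of deferred measurement. Scratch registers are
uncomputed after each encryption. This makes the simulation exact (`run_simCircuit`,
`run_challengeGates`, `acceptProb_distinguisher`), and the adversary's control program is translated
statement by statement with linear overhead per step (`emits_simProg`). -/

lemma normSq_eq_sum {ψ : State} {S : Finset Ket} (h : ψ.support ⊆ S) :
    normSq ψ = ∑ z ∈ S, ‖ψ z‖ ^ 2 :=
  Finsupp.sum_of_support_subset _ h _ (by simp)

lemma normSq_nonneg (ψ : State) : 0 ≤ normSq ψ :=
  Finset.sum_nonneg fun _ _ => sq_nonneg _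

@[simp] lemma normSq_zero : normSq 0 = 0 := by simp [normSq]

lemma normSq_smul (c : ℂ) (ψ : State) : normSq (c • ψ) = ‖c‖ ^ 2 * normSq ψ := by
  rw [normSq_eq_sum (Finsupp.support_smul (b := c) (g := ψ)), normSq_eq_sum subset_rfl,
    Finset.mul_sum]
  simp [mul_pow]

lemma normSq_neg (ψ : State) : normSq (-ψ) = normSq ψ := by
  rw [← neg_one_smul ℂ ψ, normSq_smul]; simp

/-- Expand `t (‖ψ z‖ - t⁻¹ ‖φ z‖)² ≥ 0` at each basis state. Unlike the triangle inequality for the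
norm, this weighted form survives sums and averages over outcomes; `t` is optimized only at the end.
-/
lemma normSq_add_le {t : ℝ} (ht : 0 < t) (ψ φ : State) :
    normSq (ψ + φ) ≤ (1 + t) * normSq ψ + (1 + t⁻¹) * normSq φ := by
  classical
  have h1 : (ψ + φ).support ⊆ ψ.support ∪ φ.support := Finsupp.support_add
  rw [normSq_eq_sum h1, normSq_eq_sum (Finset.subset_union_left : ψ.support ⊆ _ ∪ φ.support),
    normSq_eq_sum (Finset.subset_union_right : φ.support ⊆ ψ.support ∪ _), Finset.mul_sum,
    Finset.mul_sum, ← Finset.sum_add_distrib]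
  refine Finset.sum_le_sum fun z _ => ?_
  have h2 : ‖(ψ + φ) z‖ ≤ ‖ψ z‖ + ‖φ z‖ := norm_add_le _ _
  have h3 : ‖(ψ + φ) z‖ ^ 2 ≤ (‖ψ z‖ + ‖φ z‖) ^ 2 := by gcongr
  have h4 : t * (‖ψ z‖ - t⁻¹ * ‖φ z‖) ^ 2
      = t * ‖ψ z‖ ^ 2 + t⁻¹ * ‖φ z‖ ^ 2 - 2 * ‖ψ z‖ * ‖φ z‖ := by
    field_simp; ring
  have h5 : 0 ≤ t * (‖ψ z‖ - t⁻¹ * ‖φ z‖) ^ 2 := by positivity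
  nlinarith

lemma normSq_filter (ψ : State) (p : Ket → Prop) [DecidablePred p] :
    normSq (ψ.filter p) = ∑ z ∈ ψ.support, if p z then ‖ψ z‖ ^ 2 else 0 := by
  rw [normSq_eq_sum (S := ψ.support)]
  · refine Finset.sum_congr rfl fun z _ => ?_
    by_cases h : p z <;> simp [h]
  · rw [Finsupp.support_filter]; exact Finset.filter_subset _ _

lemma normSq_filter_le (ψ : State) (p : Ket → Prop) [DecidablePred p] :
    normSq (ψ.filter p) ≤ normSq ψ := by
  rw [normSq_filter, normSq_eq_sum subset_rfl]
  refine Finset.sum_le_sum fun z _ => ?_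
  split_ifs
  · rfl
  · positivity

lemma sum_normSq_filter_eq {α : Type} [Fintype α] [DecidableEq α] (h : Ket → α) (ψ : State) :
    ∑ a, normSq (ψ.filter fun z => h z = a) = normSq ψ := by
  simp_rw [normSq_filter]
  rw [Finset.sum_comm, normSq_eq_sum subset_rfl]
  simp

lemma sum_normSq_filter_le {α : Type} [Fintype α] (p : α → Ket → Prop)
    [∀ a, DecidablePred (p a)] (hp : ∀ a a' z, p a z → p a' z → a = a') (ψ : State) :
    ∑ a, normSq (ψ.filter (p a)) ≤ normSq ψ := by
  classical
  simp_rw [normSq_filter]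
  rw [Finset.sum_comm, normSq_eq_sum subset_rfl]
  refine Finset.sum_le_sum fun z _ => ?_
  by_cases h : ∃ a, p a z
  · obtain ⟨a, ha⟩ := h
    rw [Finset.sum_eq_single a]
    · simp [ha]
    · intro a' _ hne
      rw [if_neg fun h' => hne (hp _ _ z h' ha)]
    · simp
  · push Not at h
    simp only [h, if_false, Finset.sum_const_zero]
    positivity

lemma normSq_mapDomain {φ : Ket → Ket} (hφ : Function.Injective φ) (ψ : State) :
    normSq (ψ.mapDomain φ) = normSq ψ := by
  classical
  rw [normSq_eq_sum (S := ψ.support.image φ) Finsupp.mapDomain_support,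
    Finset.sum_image hφ.injOn, normSq_eq_sum subset_rfl]
  simp [Finsupp.mapDomain_apply hφ]

lemma filter_mapDomain (φ : Ket → Ket) (p : Ket → Prop) [DecidablePred p] (ψ : State) :
    (ψ.mapDomain φ).filter p = (ψ.filter fun z => p (φ z)).mapDomain φ := by
  induction ψ using Finsupp.induction_linear with
  | zero => simp [Finsupp.filter_zero]
  | add ψ₁ ψ₂ h₁ h₂ => rw [Finsupp.mapDomain_add, Finsupp.filter_add, h₁, h₂, Finsupp.filter_add,
      Finsupp.mapDomain_add]
  | single z a =>
    rw [Finsupp.mapDomain_single]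
    by_cases h : p (φ z)
    · rw [Finsupp.filter_single_of_pos _ h,
        Finsupp.filter_single_of_pos (fun z => p (φ z)) h, Finsupp.mapDomain_single]
    · rw [Finsupp.filter_single_of_neg _ h,
        Finsupp.filter_single_of_neg (fun z => p (φ z)) h, Finsupp.mapDomain_zero]

/-! ### Gates are isometries -/

lemma linearCombination_single_one (φ : Ket → Ket) (ψ : State) :
    Finsupp.linearCombination ℂ (fun z => Finsupp.single (φ z) (1 : ℂ)) ψ = ψ.mapDomain φ := by
  simp [Finsupp.linearCombination_apply, Finsupp.mapDomain]

lemma query_apply {Q : Type} (O : Q → Ket → Ket) (o : Q) (ψ : State) :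
    (Gate.query o).apply O ψ = ψ.mapDomain (O o) :=
  linearCombination_single_one _ _

/-- The action of a Toffoli gate on basis states. -/
def toffoliMap (c₁ c₂ t : Qubit) (z : Ket) : Ket :=
  if t = c₁ ∨ t = c₂ then z else Function.update z t (Bool.xor (z t) (z c₁ && z c₂))

lemma toffoli_apply {Q : Type} (O : Q → Ket → Ket) (c₁ c₂ t : Qubit) (ψ : State) :
    (Gate.toffoli c₁ c₂ t : Gate Q).apply O ψ = ψ.mapDomain (toffoliMap c₁ c₂ t) :=
  linearCombination_single_one _ _

lemma toffoliMap_involutive (c₁ c₂ t : Qubit) : Function.Involutive (toffoliMap c₁ c₂ t) := by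
  intro z
  unfold toffoliMap
  split_ifs with h
  · rfl
  · push Not at h
    rw [Function.update_of_ne (Ne.symm h.1), Function.update_of_ne (Ne.symm h.2)]
    simp

lemma hadamard_apply_apply {Q : Type} (O : Q → Ket → Ket) (q : Qubit) (ψ : State) (z : Ket) :
    (Gate.hadamard q : Gate Q).apply O ψ z =
      (1 / (Real.sqrt 2 : ℂ)) * (ψ (Function.update z q false) +
        (if z q then -1 else 1) * ψ (Function.update z q true)) := by
  classical
  induction ψ using Finsupp.induction_linear with
  | zero => simp
  | add ψ₁ ψ₂ h₁ h₂ => rw [map_add, Finsupp.add_apply, h₁, h₂]; simp only [Finsupp.add_apply]; ring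
  | single y a =>
    obtain ⟨A, hA⟩ : ∃ A : Prop, A ↔ ∀ x, x ≠ q → y x = z x := ⟨_, Iff.rfl⟩
    have h₁ : ∀ b, Function.update y q b = z ↔ b = z q ∧ A := fun b => by
      rw [hA, Function.update_eq_iff]
    have h₂ : ∀ b, y = Function.update z q b ↔ y q = b ∧ A := fun b => by
      rw [hA, Function.eq_update_iff]
    simp only [Gate.apply, Finsupp.linearCombination_single, Gate.onKet, Finsupp.smul_apply,
      Finsupp.add_apply, Finsupp.single_apply, smul_eq_mul, h₁, h₂]
    by_cases h : A
    · cases hz : z q <;> cases hy : y q <;> simp [h, mul_comm]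
    · simp [h]

/-- The gate mixes only the two amplitudes at `z` and at `z` with `q` flipped, and on such a pair it
preserves the sum of squares by the parallelogram law. The support is enlarged to a set `S` closed
under the flip, so that summing over `S` counts every pair twice on both sides. -/
lemma normSq_hadamard {Q : Type} (O : Q → Ket → Ket) (q : Qubit) (ψ : State) :
    normSq ((Gate.hadamard q : Gate Q).apply O ψ) = normSq ψ := by
  classical
  let flip : Ket → Ket := fun z => Function.update z q (!z q)
  have hflip : ∀ z, flip (flip z) = z := fun z => by simp [flip]
  let S : Finset Ket := ψ.support ∪ ψ.support.image flip
  have hS : ∀ z, z ∈ S → flip z ∈ S := by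
    intro z hz
    simp only [S, Finset.mem_union, Finset.mem_image] at hz ⊢
    rcases hz with hz | ⟨y, hy, rfl⟩
    · exact Or.inr ⟨z, hz, rfl⟩
    · left; rwa [hflip]
  have hupd : ∀ z b, z ∉ S → ψ (Function.update z q b) = 0 := by
    intro z b hz
    by_contra hne
    have hm : Function.update z q b ∈ ψ.support := Finsupp.mem_support_iff.2 hne
    by_cases hb : b = z q
    · subst hb
      rw [Function.update_eq_self] at hm
      exact hz (Finset.mem_union_left _ hm)
    · refine hz (Finset.mem_union_right _ (Finset.mem_image.2 ⟨_, hm, ?_⟩))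
      have : (!b) = z q := by cases b <;> cases h : z q <;> simp_all
      simp [flip, this]
  have hsupp : ((Gate.hadamard q : Gate Q).apply O ψ).support ⊆ S := by
    intro z hz
    by_contra hn
    rw [Finsupp.mem_support_iff, hadamard_apply_apply, hupd z _ hn, hupd z _ hn] at hz
    simp at hz
  have hsum : ∀ G : Ket → ℝ, ∑ z ∈ S, G (flip z) = ∑ z ∈ S, G z := fun G =>
    Finset.sum_nbij' flip flip hS hS (fun z _ => hflip z) (fun z _ => hflip z) fun z _ => rfl
  rw [normSq_eq_sum hsupp, normSq_eq_sum (Finset.subset_union_left : ψ.support ⊆ S)]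
  have key : ∀ z, ‖(Gate.hadamard q : Gate Q).apply O ψ z‖ ^ 2 +
      ‖(Gate.hadamard q : Gate Q).apply O ψ (flip z)‖ ^ 2 = ‖ψ z‖ ^ 2 + ‖ψ (flip z)‖ ^ 2 := by
    intro z
    have hs : ‖(1 / (Real.sqrt 2 : ℂ))‖ ^ 2 = 1 / 2 := by
      rw [norm_div, div_pow, Complex.norm_real]; simp
    have hp := parallelogram_law_with_norm ℂ (ψ (Function.update z q false))
      (ψ (Function.update z q true))
    simp only [hadamard_apply_apply, norm_mul, mul_pow, hs, flip, Function.update_idem,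
      Function.update_self]
    have hz : z = Function.update z q (z q) := by simp
    cases h : z q <;> rw [h] at hz <;> nth_rewrite 5 [hz] <;>
      simp only [Bool.not_true, Bool.not_false, if_true, if_false, Bool.false_eq_true, one_mul,
        neg_one_mul, ← sub_eq_add_neg] <;> linarith
  have h2 := Finset.sum_congr (rfl : S = S) fun z _ => key z
  rw [Finset.sum_add_distrib, Finset.sum_add_distrib,
    hsum (fun z => ‖(Gate.hadamard q : Gate Q).apply O ψ z‖ ^ 2), hsum (fun z => ‖ψ z‖ ^ 2)] at h2
  linarith

lemma phase_apply_apply {Q : Type} (O : Q → Ket → Ket) (q : Qubit) (ψ : State) (z : Ket) :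
    (Gate.phase q : Gate Q).apply O ψ z =
      (if z q then Complex.exp (((Real.pi / 4 : ℝ) : ℂ) * Complex.I) else 1) * ψ z := by
  classical
  induction ψ using Finsupp.induction_linear with
  | zero => simp
  | add ψ₁ ψ₂ h₁ h₂ => rw [map_add, Finsupp.add_apply, h₁, h₂]; simp only [Finsupp.add_apply]; ring
  | single y a =>
    simp only [Gate.apply, Finsupp.linearCombination_single, Gate.onKet, Finsupp.smul_apply,
      Finsupp.single_apply, smul_eq_mul]
    by_cases h : y = z
    · subst h; simp [mul_comm]
    · simp [h]

lemma normSq_apply {Q : Type} {O : Q → Ket → Ket} (hO : ∀ o, Function.Injective (O o))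
    (g : Gate Q) (ψ : State) : normSq (g.apply O ψ) = normSq ψ := by
  cases g with
  | hadamard q => exact normSq_hadamard O q ψ
  | phase q =>
    have h : ∀ z, ‖(Gate.phase q : Gate Q).apply O ψ z‖ = ‖ψ z‖ := fun z => by
      rw [phase_apply_apply, norm_mul]
      split_ifs
      · rw [Complex.norm_exp_ofReal_mul_I, one_mul]
      · simp
    rw [normSq_eq_sum (S := ψ.support), normSq_eq_sum subset_rfl]
    · simp_rw [h]
    · intro z hz
      rw [Finsupp.mem_support_iff] at hz ⊢
      intro h0
      have := h z
      rw [h0, norm_zero, norm_eq_zero] at this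
      exact hz this
  | toffoli c₁ c₂ t =>
    rw [toffoli_apply, normSq_mapDomain (toffoliMap_involutive c₁ c₂ t).injective]
  | query o => rw [query_apply, normSq_mapDomain (hO o)]

lemma xorInto_involutive {n : ℕ} (a : ℕ) (v : BitString n) :
    Function.Involutive fun z : Ket => z.xorInto a v := by
  intro z
  funext u
  simp only [Ket.xorInto]
  split_ifs <;> simp

lemma oracleMap_involutive {p q : ℕ} (f : BitString p → BitString q) (a b : ℕ) :
    Function.Involutive (oracleMap f a b) := by
  intro z
  unfold oracleMap
  split_ifs with h
  · rfl
  · have : (z.xorInto b (f (z.read a p))).read a p = z.read a p := by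
      funext i
      simp [Ket.read, Ket.xorInto, h]
    rw [this]
    exact xorInto_involutive b _ z

/-! ### Measurement functionals -/

/-- Functionals that behave like the probability of an outcome of a measurement. -/
structure IsEffect (κ : State → ℝ) : Prop where
  nonneg : ∀ ψ, 0 ≤ κ ψ
  le_normSq : ∀ ψ, κ ψ ≤ normSq ψ
  add_le : ∀ t : ℝ, 0 < t → ∀ ψ φ, κ (ψ + φ) ≤ (1 + t) * κ ψ + (1 + t⁻¹) * κ φ

lemma isEffect_outProb (b : Bool) : IsEffect (outProb b) where
  nonneg ψ := normSq_nonneg _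
  le_normSq ψ := normSq_filter_le _ _
  add_le t ht ψ φ := by
    unfold outProb
    rw [Finsupp.filter_add]
    exact normSq_add_le ht _ _

lemma IsEffect.comp {κ : State → ℝ} (hκ : IsEffect κ) (L : State →+ State)
    (hL : ∀ ψ, normSq (L ψ) ≤ normSq ψ) : IsEffect fun ψ => κ (L ψ) where
  nonneg ψ := hκ.nonneg _
  le_normSq ψ := (hκ.le_normSq _).trans (hL ψ)
  add_le t ht ψ φ := by
    simp only [map_add]
    exact hκ.add_le t ht _ _

lemma IsEffect.expect {R : Type} [Fintype R] [Nonempty R] {κ : R → State → ℝ}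
    (hκ : ∀ r, IsEffect (κ r)) : IsEffect fun ψ => 𝔼 r, κ r ψ where
  nonneg ψ := Finset.expect_nonneg fun r _ => (hκ r).nonneg ψ
  le_normSq ψ := Finset.expect_le Finset.univ_nonempty fun r _ => (hκ r).le_normSq ψ
  add_le t ht ψ φ := by
    rw [Finset.mul_expect, Finset.mul_expect, ← Finset.expect_add_distrib]
    exact Finset.expect_le_expect fun r _ => (hκ r).add_le t ht ψ φ

lemma IsEffect.sum_filter {α : Type} [Fintype α] [DecidableEq α] (h : Ket → α)
    {κ : α → State → ℝ} (hκ : ∀ a, IsEffect (κ a)) :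
    IsEffect fun ψ => ∑ a, κ a (ψ.filter fun z => h z = a) where
  nonneg ψ := Finset.sum_nonneg fun a _ => (hκ a).nonneg _
  le_normSq ψ := by
    rw [← sum_normSq_filter_eq h ψ]
    exact Finset.sum_le_sum fun a _ => (hκ a).le_normSq _
  add_le t ht ψ φ := by
    rw [Finset.mul_sum, Finset.mul_sum, ← Finset.sum_add_distrib]
    refine Finset.sum_le_sum fun a _ => ?_
    rw [Finsupp.filter_add]
    exact (hκ a).add_le t ht _ _

/-- Effects are stable under pullback along linear contractions and under averaging over the coin.
Hence the remainder of a circuit followed by a measurement is again an effect, and a hybrid step can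
be made at its first gate. -/
lemma IsEffect.expectRun {Q R : Type} [Fintype R] [Nonempty R] {O : R → Q → Ket → Ket}
    (hO : ∀ r o, Function.Injective (O r o)) {κ : State → ℝ} (hκ : IsEffect κ)
    (C : List (Gate Q)) : IsEffect (expectRun O κ C) := by
  induction C with
  | nil => exact hκ
  | cons g gs ih =>
    exact IsEffect.expect fun r => ih.comp (g.apply (O r)).toAddMonoidHom
      fun ψ => (normSq_apply (hO r) g ψ).le

/-- Allows the randomness of the challenge to be drawn before the first phase. -/
lemma expectRun_expect {Q R S : Type} [Fintype R] [Fintype S] (O : R → Q → Ket → Ket)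
    (κ : S → State → ℝ) (C : List (Gate Q)) (ψ : State) :
    expectRun O (fun φ => 𝔼 s, κ s φ) C ψ = 𝔼 s, expectRun O (κ s) C ψ := by
  induction C generalizing ψ with
  | nil => rfl
  | cons g gs ih =>
    simp only [expectRun, ih]
    exact Finset.expect_comm _ _ _

lemma expectRun_mono {Q R : Type} [Fintype R] [Nonempty R] {O : R → Q → Ket → Ket}
    (hO : ∀ r o, Function.Injective (O r o)) {κ κ' : State → ℝ} {c : ℝ}
    (h : ∀ ψ, normSq ψ ≤ 1 → κ ψ ≤ κ' ψ + c)
    (C : List (Gate Q)) {ψ : State} (hψ : normSq ψ ≤ 1) :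
    expectRun O κ C ψ ≤ expectRun O κ' C ψ + c := by
  induction C generalizing ψ with
  | nil => exact h ψ hψ
  | cons g gs ih =>
    simp only [expectRun]
    refine (Finset.expect_le_expect fun r _ =>
      ih ((normSq_apply (hO r) g ψ).trans_le hψ)).trans ?_
    rw [Finset.expect_add_distrib, Finset.expect_const Finset.univ_nonempty]

/-! ### Hybrid arguments -/

/-- Only query gates see the oracle, and there the difference comes from the part of `ψ` on which
`O' a` and `O` disagree. That part enters once through each oracle, whence the factor `4` from
`normSq_add_le` at `t = 1`. The disagreement sets are disjoint, so their masses sum to at most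
`normSq ψ`. -/
lemma sum_normSq_apply_sub_le {Q A : Type} [Fintype A] {O : Q → Ket → Ket} {O' : A → Q → Ket → Ket}
    (hO : ∀ o, Function.Injective (O o)) (hO' : ∀ a o, Function.Injective (O' a o))
    (h : ∀ o z a a', O' a o z ≠ O o z → O' a' o z ≠ O o z → a = a') (g : Gate Q) (ψ : State) :
    ∑ a, normSq (g.apply (O' a) ψ - g.apply O ψ) ≤ 4 * normSq ψ := by
  classical
  have h0 : 0 ≤ 4 * normSq ψ := mul_nonneg (by norm_num) (normSq_nonneg ψ)
  cases g with
  | hadamard q =>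
    have h1 : ∀ a, (Gate.hadamard q : Gate Q).apply (O' a) ψ = (Gate.hadamard q : Gate Q).apply O ψ :=
      fun _ => rfl
    simpa [h1] using h0
  | phase q =>
    have h1 : ∀ a, (Gate.phase q : Gate Q).apply (O' a) ψ = (Gate.phase q : Gate Q).apply O ψ :=
      fun _ => rfl
    simpa [h1] using h0
  | toffoli c₁ c₂ t =>
    have h1 : ∀ a, (Gate.toffoli c₁ c₂ t : Gate Q).apply (O' a) ψ = (Gate.toffoli c₁ c₂ t : Gate Q).apply O ψ :=
      fun _ => rfl
    simpa [h1] using h0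
  | query o =>
    have h1 : ∀ a, normSq ((Gate.query o).apply (O' a) ψ - (Gate.query o).apply O ψ) ≤
        4 * normSq (ψ.filter fun z => O' a o z ≠ O o z) := by
      intro a
      set β := ψ.filter fun z => O' a o z ≠ O o z with hβ
      set γ := ψ.filter fun z => ¬ (O' a o z ≠ O o z) with hγ
      have hsplit : ψ = β + γ := (Finsupp.filter_add_filter_not ψ _).symm
      have hγ' : γ.mapDomain (O' a o) = γ.mapDomain (O o) := by
        refine Finsupp.mapDomain_congr fun z hz => ?_
        rw [hγ, Finsupp.support_filter, Finset.mem_filter] at hz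
        exact not_not.1 hz.2
      rw [query_apply, query_apply, hsplit, Finsupp.mapDomain_add, Finsupp.mapDomain_add, hγ',
        add_sub_add_right_eq_sub, sub_eq_add_neg]
      refine (normSq_add_le one_pos _ _).trans ?_
      rw [normSq_neg, normSq_mapDomain (hO' a o), normSq_mapDomain (hO o)]
      linarith [normSq_nonneg β]
    refine (Finset.sum_le_sum fun a _ => h1 a).trans ?_
    rw [← Finset.mul_sum]
    gcongr
    exact sum_normSq_filter_le (fun a z => O' a o z ≠ O o z) (fun a a' z => h o z a a') ψ

/-- If the oracles `O' a` differ from `O` in disjoint places, then for an average `a` they are hard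
to tell from `O`. -/
lemma expect_expectRun_le {Q R A : Type} [Fintype R] [Nonempty R] [Fintype A] [Nonempty A]
    {O : R → Q → Ket → Ket} {O' : A → R → Q → Ket → Ket} {κ : A → State → ℝ}
    (hO : ∀ r o, Function.Injective (O r o)) (hO' : ∀ a r o, Function.Injective (O' a r o))
    (h : ∀ r o z a a', O' a r o z ≠ O r o z → O' a' r o z ≠ O r o z → a = a')
    (hκ : ∀ a, IsEffect (κ a)) {t : ℝ} (ht : 0 < t) (C : List (Gate Q)) {ψ : State}
    (hψ : normSq ψ ≤ 1) :
    𝔼 a, expectRun (O' a) (κ a) C ψ ≤ 𝔼 a, expectRun O (κ a) C ψ +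
      C.length * (t + (1 + t⁻¹) * (4 / Fintype.card A)) := by
  induction C generalizing ψ with
  | nil => simp [expectRun]
  | cons g gs ih =>
    simp only [expectRun]
    rw [Finset.expect_comm, Finset.expect_comm (t := (Finset.univ : Finset R)),
      ← Finset.expect_const (s := (Finset.univ : Finset R)) Finset.univ_nonempty
        (((g :: gs).length : ℝ) * _), ← Finset.expect_add_distrib]
    refine Finset.expect_le_expect fun r _ => ?_
    have hr : normSq (g.apply (O r) ψ) ≤ 1 := (normSq_apply (hO r) g ψ).trans_le hψ
    -- Change the oracle in the first gate only: the new state is the old one plus a difference, and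
    -- the remaining circuit, still with `O' a`, is an effect. The term `t` pays for the weight `1 +
    -- t`, since the effect is at most `1` on the old state.
    have step : ∀ a, QCrypto.expectRun (O' a) (κ a) gs (g.apply (O' a r) ψ) ≤
        QCrypto.expectRun (O' a) (κ a) gs (g.apply (O r) ψ) +
          (t + (1 + t⁻¹) * normSq (g.apply (O' a r) ψ - g.apply (O r) ψ)) := by
      intro a
      have he := (hκ a).expectRun (hO' a) gs
      have h1 := he.add_le t ht (g.apply (O r) ψ) (g.apply (O' a r) ψ - g.apply (O r) ψ)
      rw [add_sub_cancel] at h1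
      have h2 := (he.le_normSq (g.apply (O r) ψ)).trans hr
      have h3 := he.le_normSq (g.apply (O' a r) ψ - g.apply (O r) ψ)
      have h4 : 0 ≤ 1 + t⁻¹ := by positivity
      nlinarith [mul_le_mul_of_nonneg_left h3 h4]
    refine (Finset.expect_le_expect fun a _ => step a).trans ?_
    rw [Finset.expect_add_distrib, Finset.expect_add_distrib,
      Finset.expect_const Finset.univ_nonempty, ← Finset.mul_expect]
    -- The differences have total mass at most `4` over all `a`, so averaging gains the factor `1 /
    -- card A`.
    have h5 : 𝔼 a, normSq (g.apply (O' a r) ψ - g.apply (O r) ψ) ≤ 4 / Fintype.card A := by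
      rw [Fintype.expect_eq_sum_div_card]
      gcongr
      refine (sum_normSq_apply_sub_le (hO r) (fun a => hO' a r) (h r) g ψ).trans ?_
      linarith
    have h6 := ih hr
    have h7 : 0 ≤ 1 + t⁻¹ := by positivity
    have h8 := mul_le_mul_of_nonneg_left h5 h7
    push_cast [List.length_cons]
    linarith

/-- Oracles that differ for one value of the coin only are hard to tell apart. -/
lemma expectRun_le_of_coin_ne {Q R : Type} [Fintype R] [Nonempty R]
    {O O' : R → Q → Ket → Ket} {κ : State → ℝ}
    (hO : ∀ r o, Function.Injective (O r o)) (hO' : ∀ r o, Function.Injective (O' r o))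
    (r₀ : R) (h : ∀ r, r ≠ r₀ → O' r = O r) (hκ : IsEffect κ) (C : List (Gate Q)) (ψ : State) :
    expectRun O' κ C ψ ≤ expectRun O κ C ψ + C.length / Fintype.card R * normSq ψ := by
  classical
  induction C generalizing ψ with
  | nil => simp [expectRun]
  | cons g gs ih =>
    simp only [expectRun]
    have hN := normSq_nonneg ψ
    have step : ∀ r, QCrypto.expectRun O' κ gs (g.apply (O' r) ψ) ≤
        QCrypto.expectRun O κ gs (g.apply (O r) ψ) +
          (gs.length / Fintype.card R * normSq ψ + if r = r₀ then normSq ψ else 0) := by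
      intro r
      -- For the bad coin, which has probability `1 / card R`, the trivial bound by the squared norm
      -- suffices; for every other coin the gates coincide.
      by_cases hr : r = r₀
      · have h1 := (hκ.expectRun hO' gs).le_normSq (g.apply (O' r) ψ)
        rw [normSq_apply (hO' r)] at h1
        have h2 := (hκ.expectRun hO gs).nonneg (g.apply (O r) ψ)
        have h3 : 0 ≤ gs.length / Fintype.card R * normSq ψ := by positivity
        rw [if_pos hr]; linarith
      · have h1 := ih (g.apply (O r) ψ)
        rw [normSq_apply (hO r)] at h1
        rw [if_neg hr, h r hr]; linarith
    refine (Finset.expect_le_expect fun r _ => step r).trans ?_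
    rw [Finset.expect_add_distrib, Finset.expect_add_distrib,
      Finset.expect_const Finset.univ_nonempty]
    have h2 : 𝔼 r, (if r = r₀ then normSq ψ else 0) = normSq ψ / Fintype.card R := by
      rw [Fintype.expect_eq_sum_div_card]; simp
    rw [h2]
    push_cast [List.length_cons]
    apply le_of_eq; ring

/-! ### The security game relative to a function -/

variable {n : ℕ}

/-- The encryption of `m` with randomness `r`, relative to the function `f`. -/
def encFun (f : BitString n → BitString n) (m r : BitString n) : BitString (n + n) :=
  Fin.append r (bxor (f r) m)

/-- The decryption of `c`, relative to the function `f`. -/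
def decFun (f : BitString n → BitString n) (c : BitString (n + n)) : BitString n :=
  bxor (fun i => c (Fin.natAdd n i)) (f fun i => c (Fin.castAdd n i))

/-- The encryption and decryption oracles relative to the function `f`. -/
def gameOracle (f : BitString n → BitString n) (r : BitString n) : EncDecQuery → Ket → Ket
  | .enc m c => oracleMap (fun x => encFun f x r) m c
  | .dec c m => oracleMap (decFun f) c m

/-- Encryption queries are among the queries of the first phase. -/
def EncQuery.toEncDec : EncQuery → EncDecQuery
  | .enc m c => .enc m c

/-- The probability of outcome `b` in the second phase of the game, when the challenge is `v`. -/
def phaseTwoProb (f : BitString n → BitString n) (C : List (Gate EncQuery)) (b : Bool)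
    (v : BitString (n + n)) (ψ : State) : ℝ :=
  expectRun (fun r o => gameOracle f r (EncQuery.toEncDec o)) (outProb b) C
    (ψ.mapDomain fun z => z.xorInto 2 v)

/-- The probability of outcome `b` in the second phase of the game, starting with the measurement of
the messages, when `r` is the randomness of the challenge and `s` is the mask of the message. -/
def challengeValue (f : BitString n → BitString n) (C : List (Gate EncQuery)) (b : Bool)
    (r s : BitString n) (ψ : State) : ℝ :=
  ∑ m₀ : BitString n, ∑ m₁ : BitString n,
    phaseTwoProb f C b (Fin.append r (bxor s (if b then m₁ else m₀)))
      (ψ.filter fun z => z.read 0 n = m₀ ∧ z.read 1 n = m₁)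

/-- The probability that the adversary guesses the challenge bit `b` in the game relative to `f`. -/
def gameProb (f : BitString n → BitString n) (C₁ : List (Gate EncDecQuery))
    (C₂ : List (Gate EncQuery)) (b : Bool) : ℝ :=
  expectRun (gameOracle f) (fun ψ => 𝔼 r, challengeValue f C₂ b r (f r) ψ) C₁ zeroState

lemma expect_sum_sum_comm {α β γ : Type} [Fintype α] [Fintype β] [Fintype γ]
    (g : α → β → γ → ℝ) : 𝔼 a, ∑ b, ∑ c, g a b c = ∑ b, ∑ c, 𝔼 a, g a b c := by
  simp_rw [Finset.expect_sum_comm]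

lemma guessProb_prfScheme (F : ∀ n, BitString n → BitString n → BitString n) (n : ℕ)
    (C₁ : List (Gate EncDecQuery)) (C₂ : List (Gate EncQuery)) (k : BitString n) (b : Bool) :
    guessProb (prfScheme F) n C₁ C₂ k b = gameProb (F n k) C₁ C₂ b := by
  have h₁ : encDecOracle (prfScheme F) n k = gameOracle (F n k) := by
    funext r o; cases o <;> rfl
  have h₂ : encOracle (prfScheme F) n k =
      fun r o => gameOracle (F n k) r (EncQuery.toEncDec o) := by
    funext r o; cases o; rfl
  unfold guessProb gameProb
  rw [h₁, h₂]
  congr 1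
  funext ψ
  simp only [challengeValue]
  rw [expect_sum_sum_comm]
  rfl

lemma gameOracle_injective (f : BitString n → BitString n) (r : BitString n) (o : EncDecQuery) :
    Function.Injective (gameOracle f r o) := by
  cases o with
  | enc m c => exact (oracleMap_involutive (fun x => encFun f x r) m c).injective
  | dec c m => exact (oracleMap_involutive (decFun f) c m).injective

/-- Measuring the two messages is one measurement with outcomes in a product, so the
single-measurement facts about `filter` apply. -/
lemma sum_sum_filter_and {α β : Type} [Fintype α] [Fintype β] [DecidableEq α] [DecidableEq β]
    (h : Ket → α) (k : Ket → β) (G : α → β → State → ℝ) (ψ : State) :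
    ∑ a, ∑ b, G a b (ψ.filter fun z => h z = a ∧ k z = b) =
      ∑ p : α × β, G p.1 p.2 (ψ.filter fun z => (h z, k z) = p) := by
  rw [Fintype.sum_prod_type]
  refine Finset.sum_congr rfl fun a _ => Finset.sum_congr rfl fun b _ => ?_
  congr 1
  ext z
  simp [Finsupp.filter_apply]

lemma isEffect_phaseTwoProb (f : BitString n → BitString n) (C : List (Gate EncQuery)) (b : Bool)
    (v : BitString (n + n)) : IsEffect (phaseTwoProb f C b v) :=
  ((isEffect_outProb b).expectRun (fun r _ => gameOracle_injective f r _) C).comp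
    (Finsupp.mapDomain.addMonoidHom _)
    fun ψ => (normSq_mapDomain (xorInto_involutive 2 v).injective ψ).le

lemma isEffect_challengeValue (f : BitString n → BitString n) (C : List (Gate EncQuery)) (b : Bool)
    (r s : BitString n) : IsEffect (challengeValue f C b r s) := by
  have h := IsEffect.sum_filter (fun z : Ket => (z.read 0 n, z.read 1 n))
    (κ := fun p => phaseTwoProb f C b (Fin.append r (bxor s (if b then p.2 else p.1))))
    fun p => isEffect_phaseTwoProb f C b _
  have e : challengeValue f C b r s = fun ψ => ∑ p : BitString n × BitString n,
      phaseTwoProb f C b (Fin.append r (bxor s (if b then p.2 else p.1)))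
        (ψ.filter fun z => (z.read 0 n, z.read 1 n) = p) := by
    funext ψ
    exact sum_sum_filter_and (fun z : Ket => z.read 0 n) (fun z : Ket => z.read 1 n)
      (fun m₀ m₁ => phaseTwoProb f C b (Fin.append r (bxor s (if b then m₁ else m₀)))) ψ
  rw [e]
  exact h

lemma sum_normSq_messages (ψ : State) :
    ∑ m₀ : BitString n, ∑ m₁ : BitString n,
      normSq (ψ.filter fun z => z.read 0 n = m₀ ∧ z.read 1 n = m₁) = normSq ψ := by
  rw [sum_sum_filter_and (fun z : Ket => z.read 0 n) (fun z : Ket => z.read 1 n)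
    (fun _ _ ψ => normSq ψ) ψ]
  exact sum_normSq_filter_eq (fun z : Ket => (z.read 0 n, z.read 1 n)) ψ

/-! ### The game with a uniformly random function -/

/-- Resampling one value of a uniformly random function. -/
lemma expect_update {α β : Type} [Fintype α] [DecidableEq α] [Fintype β] [Nonempty β]
    (a : α) (H : (α → β) → β → ℝ) :
    𝔼 f : α → β, H f (f a) = 𝔼 f : α → β, 𝔼 s, H (Function.update f a s) s := by
  -- Exchanging the value at `a` with the extra sample is an involution of `(α → β) × β`.
  have h1 : ∑ p : (α → β) × β, H (Function.update p.1 a p.2) p.2 =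
      ∑ p : (α → β) × β, H p.1 (p.1 a) :=
    Finset.sum_nbij' (fun p => (Function.update p.1 a p.2, p.1 a))
      (fun p => (Function.update p.1 a p.2, p.1 a)) (by simp) (by simp) (by simp) (by simp)
      (by simp)
  rw [Fintype.sum_prod_type, Fintype.sum_prod_type] at h1
  simp_rw [Fintype.expect_eq_sum_div_card, ← Finset.sum_div]
  rw [h1]
  simp [Finset.sum_const, ← Finset.mul_sum]

/-- On a fixed basis state with a fixed coin, a query evaluates `f` at one point only: the coin for
encryption, the first half of the ciphertext for decryption. This is the disjointness needed in
`expect_expectRun_le`. -/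
lemma gameOracle_update_ne (f : BitString n → BitString n) (s r : BitString n) (o : EncDecQuery)
    (z : Ket) : ∃ a₀, ∀ a, gameOracle (Function.update f a s) r o z ≠ gameOracle f r o z →
      a = a₀ := by
  cases o with
  | enc m c =>
    refine ⟨r, fun a h => ?_⟩
    by_contra hne
    refine h ?_
    simp only [gameOracle, encFun, Function.update_of_ne (Ne.symm hne)]
  | dec c m =>
    refine ⟨fun i => z.read c (n + n) (Fin.castAdd n i), fun a h => ?_⟩
    by_contra hne
    refine h ?_
    simp only [gameOracle, oracleMap, decFun, Function.update_of_ne (Ne.symm hne)]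

/-- The run does not depend on `b`, and the probabilities of the two outcomes add up to the squared
norm, which the gates preserve. -/
lemma expect_expectRun_outProb {Q R : Type} [Fintype R] [Nonempty R] {O : R → Q → Ket → Ket}
    (hO : ∀ r o, Function.Injective (O r o)) (C : List (Gate Q)) (ψ : State) :
    𝔼 b : Bool, expectRun O (outProb b) C ψ = normSq ψ / 2 := by
  induction C generalizing ψ with
  | nil =>
    rw [Fintype.expect_eq_sum_div_card, ← sum_normSq_filter_eq (fun z => z outQubit) ψ]
    simp [expectRun, outProb]
  | cons g gs ih =>
    simp only [expectRun]
    rw [Finset.expect_comm]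
    simp_rw [ih, normSq_apply (hO _)]
    rw [Finset.expect_const Finset.univ_nonempty]

lemma expect_bxor (m : BitString n) (g : BitString n → ℝ) :
    𝔼 s, g (bxor s m) = 𝔼 s, g s := by
  have hinv : Function.Involutive fun s : BitString n => bxor s m := fun s => by
    funext i; simp [bxor]
  exact Fintype.expect_equiv hinv.toPerm _ _ fun s => rfl

/-- A uniform mask hides the challenge bit. -/
lemma expect_challengeValue (f : BitString n → BitString n) (C : List (Gate EncQuery))
    (r : BitString n) (ψ : State) :
    𝔼 b : Bool, 𝔼 s, challengeValue f C b r s ψ = normSq ψ / 2 := by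
  simp only [challengeValue]
  simp_rw [expect_sum_sum_comm]
  have h : ∀ (b : Bool) (m₀ m₁ : BitString n) (φ : State),
      𝔼 s, phaseTwoProb f C b (Fin.append r (bxor s (if b then m₁ else m₀))) φ =
      𝔼 s, phaseTwoProb f C b (Fin.append r s) φ :=
    fun b m₀ m₁ φ => expect_bxor (if b then m₁ else m₀) fun s =>
      phaseTwoProb f C b (Fin.append r s) φ
  simp_rw [h]
  rw [← sum_normSq_messages (n := n) ψ, Finset.sum_div]
  refine Finset.sum_congr rfl fun m₀ _ => ?_
  rw [Finset.sum_div]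
  refine Finset.sum_congr rfl fun m₁ _ => ?_
  rw [Finset.expect_comm]
  simp_rw [phaseTwoProb, expect_expectRun_outProb (fun r o => gameOracle_injective f r _),
    normSq_mapDomain (xorInto_involutive 2 _).injective]
  rw [Finset.expect_const Finset.univ_nonempty]

/-- Encryption queries read `f` only at their fresh coin, which hits `r` with probability `2⁻ⁿ` per
gate. This is where the absence of a decryption oracle after the challenge is used: decryption of
`(r, 0)` would reveal the mask. -/
lemma challengeValue_update_le (f : BitString n → BitString n) (C : List (Gate EncQuery)) (b : Bool)
    (r s : BitString n) {ψ : State} (hψ : normSq ψ ≤ 1) :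
    challengeValue (Function.update f r s) C b r s ψ ≤
      challengeValue f C b r s ψ + C.length / 2 ^ n := by
  unfold challengeValue
  have hcard : (Fintype.card (BitString n) : ℝ) = 2 ^ n := by simp
  have h : ∀ v φ, phaseTwoProb (Function.update f r s) C b v φ ≤
      phaseTwoProb f C b v φ + C.length / 2 ^ n * normSq φ := by
    intro v φ
    unfold phaseTwoProb
    rw [← normSq_mapDomain (xorInto_involutive 2 v).injective φ]
    rw [← hcard]
    refine expectRun_le_of_coin_ne (fun r o => gameOracle_injective f r _)
      (fun _ o => gameOracle_injective _ _ _) r (fun r' hr => ?_) (isEffect_outProb b) C _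
    funext o z
    cases o
    simp only [EncQuery.toEncDec, gameOracle, encFun, Function.update_of_ne hr]
  refine (Finset.sum_le_sum fun m₀ _ => Finset.sum_le_sum fun m₁ _ => h _ _).trans ?_
  simp_rw [Finset.sum_add_distrib, ← Finset.mul_sum, sum_normSq_messages]
  have : (0 : ℝ) ≤ C.length / 2 ^ n := by positivity
  linarith [mul_le_mul_of_nonneg_left hψ this]

lemma normSq_zeroState : normSq zeroState = 1 := by
  simp [normSq, zeroState]

lemma expectRun_zero {Q R : Type} [Fintype R] [Nonempty R] (O : R → Q → Ket → Ket)
    (C : List (Gate Q)) (ψ : State) : expectRun O (fun _ => 0) C ψ = 0 := by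
  induction C generalizing ψ with
  | nil => rfl
  | cons g gs ih => simp [expectRun, ih]

/-- The oracle no longer depends on the mask `s`, so the average over `s` may be taken inside, after
the first phase, where the one-time pad applies. -/
lemma expect_expectRun_challengeValue_le (f : BitString n → BitString n)
    (C₁ : List (Gate EncDecQuery)) (C₂ : List (Gate EncQuery)) :
    𝔼 b : Bool, 𝔼 s, 𝔼 r, expectRun (gameOracle f) (challengeValue f C₂ b r s) C₁ zeroState ≤
      1 / 2 := by
  simp_rw [← expectRun_expect]
  have h := expectRun_mono (gameOracle_injective f)
    (κ := fun ψ => 𝔼 b : Bool, 𝔼 s, 𝔼 r, challengeValue f C₂ b r s ψ) (κ' := fun _ => 0)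
    (c := 1 / 2) ?_ C₁ normSq_zeroState.le
  · rwa [expectRun_zero, zero_add] at h
  · intro ψ hψ
    have h1 : ∀ b : Bool, 𝔼 s, 𝔼 r, challengeValue f C₂ b r s ψ =
        𝔼 r, 𝔼 s, challengeValue f C₂ b r s ψ := fun b => Finset.expect_comm _ _ _
    simp_rw [h1]
    rw [Finset.expect_comm]
    simp_rw [expect_challengeValue]
    rw [Finset.expect_const Finset.univ_nonempty]
    linarith

/-- With a uniformly random function the adversary can hardly do better than guess. -/
theorem expect_gameProb_le (C₁ : List (Gate EncDecQuery)) (C₂ : List (Gate EncQuery)) {t : ℝ}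
    (ht : 0 < t) :
    𝔼 f : BitString n → BitString n, 𝔼 b : Bool, gameProb f C₁ C₂ b ≤
      1 / 2 + (C₁.length * (t + (1 + t⁻¹) * (4 / 2 ^ n)) + C₂.length / 2 ^ n) := by
  let X : (BitString n → BitString n) → Bool → BitString n → BitString n → ℝ := fun f b r s =>
    expectRun (gameOracle f) (challengeValue f C₂ b r s) C₁ zeroState
  -- Fix the challenge coin `r` in advance and resample the value of `f` there.
  have h1 : 𝔼 f : BitString n → BitString n, 𝔼 b : Bool, gameProb f C₁ C₂ b =
      𝔼 f : BitString n → BitString n, 𝔼 b : Bool, 𝔼 s, 𝔼 r, X (Function.update f r s) b r s := by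
    have e1 : ∀ f b, gameProb f C₁ C₂ b = 𝔼 r, X f b r (f r) := fun f b =>
      expectRun_expect _ _ _ _
    simp_rw [e1]
    rw [Finset.expect_comm, Finset.expect_comm (s := (Finset.univ : Finset (BitString n → _)))
      (t := (Finset.univ : Finset Bool))]
    refine Finset.expect_congr rfl fun b _ => ?_
    rw [Finset.expect_comm]
    have e2 : ∀ r, 𝔼 f : BitString n → BitString n, X f b r (f r) =
        𝔼 f : BitString n → BitString n, 𝔼 s, X (Function.update f r s) b r s := fun r =>
      expect_update r fun f s => X f b r s
    simp_rw [e2]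
    rw [Finset.expect_comm]
    exact Finset.expect_congr rfl fun f _ => Finset.expect_comm _ _ _
  rw [h1]
  refine Finset.expect_le Finset.univ_nonempty fun f _ => ?_
  have hcard : (Fintype.card (BitString n) : ℝ) = 2 ^ n := by simp
  -- For fixed `f`, `b`, `s`, remove the update at `r` from both phases; only the average over `r`
  -- is controlled in the first phase.
  have h2 : ∀ b s, 𝔼 r, X (Function.update f r s) b r s ≤ 𝔼 r, X f b r s +
      (C₁.length * (t + (1 + t⁻¹) * (4 / 2 ^ n)) + C₂.length / 2 ^ n) := by
    intro b s
    -- First phase: the final effect still contains the updated function, which is harmless because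
    -- it may depend on `r`.
    have h3 := expect_expectRun_le (A := BitString n) (O := gameOracle f)
      (O' := fun a => gameOracle (Function.update f a s))
      (κ := fun r => challengeValue (Function.update f r s) C₂ b r s)
      (gameOracle_injective f) (fun a => gameOracle_injective _) (fun r o z a a' ha ha' => by
        obtain ⟨a₀, h⟩ := gameOracle_update_ne f s r o z
        rw [h a ha, h a' ha'])
      (fun r => isEffect_challengeValue _ _ _ _ _) ht C₁ normSq_zeroState.le
    have h4 : ∀ r, expectRun (gameOracle f) (challengeValue (Function.update f r s) C₂ b r s) C₁
        zeroState ≤ X f b r s + C₂.length / 2 ^ n := fun r =>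
      expectRun_mono (gameOracle_injective f)
        (fun ψ hψ => challengeValue_update_le f C₂ b r s hψ) C₁ normSq_zeroState.le
    have h5 := Finset.expect_le_expect (s := Finset.univ) fun r _ => h4 r
    rw [Finset.expect_add_distrib, Finset.expect_const Finset.univ_nonempty] at h5
    rw [hcard] at h3
    linarith
  refine (Finset.expect_le_expect fun b _ => Finset.expect_le_expect fun s _ => h2 b s).trans ?_
  simp_rw [Finset.expect_add_distrib]
  simp only [Finset.expect_const Finset.univ_nonempty]
  have := expect_expectRun_challengeValue_le f C₁ C₂
  linarith

/-! ### Circuits with a deterministic oracle -/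

/-- The action of a circuit on states. -/
def run {Q : Type} (O : Q → Ket → Ket) : List (Gate Q) → State →ₗ[ℂ] State
  | [] => LinearMap.id
  | g :: gs => run O gs ∘ₗ g.apply O

@[simp] lemma run_nil {Q : Type} (O : Q → Ket → Ket) (ψ : State) : run O [] ψ = ψ := rfl

lemma run_cons {Q : Type} (O : Q → Ket → Ket) (g : Gate Q) (C : List (Gate Q)) (ψ : State) :
    run O (g :: C) ψ = run O C (g.apply O ψ) := rfl

lemma run_append {Q : Type} (O : Q → Ket → Ket) (C C' : List (Gate Q)) (ψ : State) :
    run O (C ++ C') ψ = run O C' (run O C ψ) := by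
  induction C generalizing ψ with
  | nil => rfl
  | cons g gs ih => exact ih _

lemma expectRun_unit {Q : Type} (O : Q → Ket → Ket) (κ : State → ℝ) (C : List (Gate Q))
    (ψ : State) : expectRun (fun _ : Unit => O) κ C ψ = κ (run O C ψ) := by
  induction C generalizing ψ with
  | nil => rfl
  | cons g gs ih => simp [expectRun, ih, run_cons]

/-! ### Qubits without interference -/

/-- The functional `E` is quadratic and does not see interference between states which differ in a
qubit from `U`. -/
structure IsDecohered (U : Set Qubit) (E : State → ℝ) : Prop where
  smul : ∀ (c : ℂ) (ψ : State), E (c • ψ) = ‖c‖ ^ 2 * E ψ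
  split : ∀ u ∈ U, ∀ ψ : State,
    E ψ = E (ψ.filter fun z => z u = true) + E (ψ.filter fun z => z u = false)

lemma IsDecohered.mono {U V : Set Qubit} {E : State → ℝ} (hE : IsDecohered U E) (h : V ⊆ U) :
    IsDecohered V E :=
  ⟨hE.smul, fun u hu => hE.split u (h hu)⟩

/-- The gate does not change the qubits in `U`. -/
def Gate.Fixes (U : Set Qubit) : Gate FunQuery → Prop
  | .hadamard q => q ∉ U
  | .phase _ => True
  | .toffoli _ _ t => t ∉ U
  | .query (.eval x y) => x = y ∨ ∀ i, (y, i) ∉ U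

lemma Gate.Fixes.mono {U V : Set Qubit} {g : Gate FunQuery} (hg : g.Fixes U) (h : V ⊆ U) :
    g.Fixes V := by
  rcases g with q | q | ⟨c₁, c₂, t⟩ | ⟨x, y⟩
  · exact fun hq => hg (h hq)
  · trivial
  · exact fun hq => hg (h hq)
  · exact hg.imp_right fun h' i hi => h' i (h hi)

lemma filter_single (p : Ket → Prop) [DecidablePred p] (z : Ket) (a : ℂ) :
    (Finsupp.single z a).filter p = if p z then Finsupp.single z a else 0 := by
  split_ifs with h
  · exact Finsupp.filter_single_of_pos _ h
  · exact Finsupp.filter_single_of_neg _ h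

/-- A gate may use `u` as a control, as a query input or diagonally; as long as it does not write to
`u`, it commutes with the projections onto the values of `u`. -/
lemma Gate.Fixes.filter_apply {U : Set Qubit} {g : Gate FunQuery} (hg : g.Fixes U) {u : Qubit}
    (hu : u ∈ U) (b : Bool) (f : BitString n → BitString n) (ψ : State) :
    (g.apply (funOracle f) ψ).filter (fun z => z u = b) =
      g.apply (funOracle f) (ψ.filter fun z => z u = b) := by
  induction ψ using Finsupp.induction_linear with
  | zero => simp [Finsupp.filter_zero]
  | add ψ₁ ψ₂ h₁ h₂ => rw [map_add, Finsupp.filter_add, h₁, h₂, Finsupp.filter_add, map_add]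
  | single z a =>
    rw [filter_single, apply_ite (g.apply (funOracle f)), map_zero]
    simp only [Gate.apply, Finsupp.linearCombination_single, Finsupp.filter_smul]
    have key : (g.onKet (funOracle f) z).filter (fun z => z u = b) =
        if z u = b then g.onKet (funOracle f) z else 0 := by
      rcases g with q | q | ⟨c₁, c₂, t⟩ | ⟨x, y⟩
      · have hq : u ≠ q := fun h => hg (h ▸ hu)
        simp only [Gate.onKet, Finsupp.filter_add, filter_single, Function.update_of_ne hq]
        split_ifs <;> simp
      · simp only [Gate.onKet, filter_single]
      · have hq : u ≠ t := fun h => hg (h ▸ hu)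
        simp only [Gate.onKet, filter_single]
        by_cases h : t = c₁ ∨ t = c₂
        · simp only [h, if_true]
        · simp only [h, if_false, Function.update_of_ne hq]
      · have hq : funOracle f (.eval x y) z u = z u := by
          simp only [funOracle, oracleMap]
          split_ifs with hxy
          · rfl
          · have h1 := hg.resolve_left hxy
            simp only [Ket.xorInto]
            rw [dif_neg]
            rintro ⟨h2, -⟩
            exact h1 u.2 (by rw [← h2]; exact hu)
        simp only [Gate.onKet, filter_single, hq]
    rw [key]
    split_ifs <;> simp

lemma IsDecohered.apply {U : Set Qubit} {E : State → ℝ} (hE : IsDecohered U E) {g : Gate FunQuery}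
    (hg : g.Fixes U) (f : BitString n → BitString n) :
    IsDecohered U fun ψ => E (g.apply (funOracle f) ψ) where
  smul c ψ := by rw [map_smul, hE.smul]
  split u hu ψ := by
    rw [hE.split u hu, hg.filter_apply hu, hg.filter_apply hu]

/-- Deferred measurement: the projections onto the values of an unchanged qubit can be moved from
the end of the circuit to its beginning. -/
lemma IsDecohered.run {U : Set Qubit} {E : State → ℝ} (hE : IsDecohered U E)
    {C : List (Gate FunQuery)} (hC : ∀ g ∈ C, g.Fixes U) (f : BitString n → BitString n) :
    IsDecohered U fun ψ => E (run (funOracle f) C ψ) := by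
  induction C with
  | nil => exact hE
  | cons g gs ih =>
    exact (ih fun g' hg' => hC g' (List.mem_cons_of_mem _ hg')).apply
      (hC g List.mem_cons_self) f

lemma isDecohered_normSq_filter (U : Set Qubit) (p : Ket → Prop) [DecidablePred p] :
    IsDecohered U fun ψ => normSq (ψ.filter p) where
  smul c ψ := by rw [Finsupp.filter_smul, normSq_smul]
  split u _ ψ := by
    rw [← sum_normSq_filter_eq (fun z => z u) (ψ.filter p), Fintype.sum_bool]
    congr 2 <;> (ext z; simp only [Finsupp.filter_apply]; split_ifs <;> rfl)

/-- Measuring several qubits. -/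
lemma IsDecohered.sum_filter {U : Set Qubit} {E : State → ℝ} (hE : IsDecohered U E) {k : ℕ}
    (u : Fin k → Qubit) (hu : ∀ i, u i ∈ U) (ψ : State) :
    E ψ = ∑ m : BitString k, E (ψ.filter fun z => (fun i => z (u i)) = m) := by
  induction k generalizing ψ with
  | zero =>
    rw [Fintype.sum_unique]
    congr 1
    ext z
    rw [Finsupp.filter_apply, if_pos (Subsingleton.elim _ _)]
  | succ k ih =>
    have h : ∀ b, E (ψ.filter fun z => z (u 0) = b) = ∑ m : BitString k,
        E (ψ.filter fun z => (fun i => z (u i)) = (Fin.cons b m : BitString (k + 1))) := by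
      intro b
      rw [ih (fun i => u i.succ) (fun i => hu _)]
      refine Finset.sum_congr rfl fun m _ => ?_
      congr 1
      ext z
      have e : (fun i => z (u i)) = (Fin.cons b m : BitString (k + 1)) ↔
          z (u 0) = b ∧ (fun i : Fin k => z (u i.succ)) = m := by
        simp only [funext_iff, Fin.forall_fin_succ, Fin.cons_zero, Fin.cons_succ]
      simp only [Finsupp.filter_apply, e]
      by_cases h1 : z (u 0) = b <;> simp [h1]
    rw [hE.split (u 0) (hu 0), h, h,
      ← Equiv.sum_comp (Fin.consEquiv fun _ : Fin (k + 1) => Bool), Fintype.sum_prod_type,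
      Fintype.sum_bool]
    rfl

/-! ### Auxiliary qubits

The arrays `0`, …, `5` hold the auxiliary qubits of the distinguisher, and its array `a + 6` is the
array `a` of the adversary. -/

/-- The basis state with auxiliary qubits `w` and adversary `z`. -/
def joinKet (w z : Ket) : Ket := fun u => if u.1 < 6 then w u else z (u.1 - 6, u.2)

/-- The state with auxiliary qubits `w` and adversary `ψ`. -/
def embed (w : Ket) (ψ : State) : State := ψ.mapDomain (joinKet w)

lemma embed_add (w : Ket) (ψ φ : State) : embed w (ψ + φ) = embed w ψ + embed w φ :=
  Finsupp.mapDomain_add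

lemma embed_single (w z : Ket) (a : ℂ) :
    embed w (Finsupp.single z a) = Finsupp.single (joinKet w z) a :=
  Finsupp.mapDomain_single

lemma embed_zero (w : Ket) : embed w 0 = 0 := Finsupp.mapDomain_zero

lemma joinKet_injective (w : Ket) : Function.Injective (joinKet w) := by
  intro z z' h
  funext u
  simpa [joinKet] using congrFun h (u.1 + 6, u.2)

/-- The qubit of the distinguisher that is the qubit `q` of the adversary. -/
def liftQubit (q : Qubit) : Qubit := (q.1 + 6, q.2)

@[simp] lemma joinKet_liftQubit (w z : Ket) (q : Qubit) : joinKet w z (liftQubit q) = z q := by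
  simp [joinKet, liftQubit]

lemma joinKet_of_lt (w z : Ket) {u : Qubit} (h : u.1 < 6) : joinKet w z u = w u := if_pos h

lemma joinKet_add (w z : Ket) (a i : ℕ) : joinKet w z (a + 6, i) = z (a, i) :=
  joinKet_liftQubit w z (a, i)

lemma liftQubit_injective : Function.Injective liftQubit := by
  intro p q h
  simpa [liftQubit, Prod.ext_iff] using h

lemma joinKet_update (w z : Ket) (q : Qubit) (b : Bool) :
    joinKet w (Function.update z q b) = Function.update (joinKet w z) (liftQubit q) b := by
  funext u
  rcases lt_or_ge u.1 6 with h | h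
  · have hne : u ≠ liftQubit q := by rintro rfl; simp [liftQubit] at h
    rw [Function.update_of_ne hne, joinKet_of_lt _ _ h, joinKet_of_lt _ _ h]
  · obtain ⟨v, rfl⟩ : ∃ v, u = liftQubit v :=
      ⟨(u.1 - 6, u.2), by ext <;> simp [liftQubit]; omega⟩
    rw [joinKet_liftQubit]
    by_cases hv : v = q
    · subst hv; simp
    · rw [Function.update_of_ne hv, Function.update_of_ne (liftQubit_injective.ne hv),
        joinKet_liftQubit]

lemma update_joinKet (w z : Ket) {u : Qubit} (hu : u.1 < 6) (b : Bool) :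
    Function.update (joinKet w z) u b = joinKet (Function.update w u b) z := by
  funext v
  by_cases h : v = u
  · subst h; simp [joinKet, hu]
  · simp [joinKet, Function.update_of_ne h]

lemma hadamard_embed {Q Q' : Type} (O : Q → Ket → Ket) (O' : Q' → Ket → Ket) (q : Qubit) (w : Ket)
    (ψ : State) : (Gate.hadamard (liftQubit q) : Gate Q).apply O (embed w ψ) =
      embed w ((Gate.hadamard q : Gate Q').apply O' ψ) := by
  induction ψ using Finsupp.induction_linear with
  | zero => simp [embed_zero]
  | add ψ₁ ψ₂ h₁ h₂ => rw [embed_add, map_add, h₁, h₂, map_add, embed_add]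
  | single z a =>
    rw [embed_single]
    simp only [Gate.apply, Finsupp.linearCombination_single, Gate.onKet, smul_add, embed_add,
      Finsupp.smul_single, embed_single, joinKet_update, joinKet_liftQubit]

lemma phase_embed {Q Q' : Type} (O : Q → Ket → Ket) (O' : Q' → Ket → Ket) (q : Qubit) (w : Ket)
    (ψ : State) : (Gate.phase (liftQubit q) : Gate Q).apply O (embed w ψ) =
      embed w ((Gate.phase q : Gate Q').apply O' ψ) := by
  induction ψ using Finsupp.induction_linear with
  | zero => simp [embed_zero]
  | add ψ₁ ψ₂ h₁ h₂ => rw [embed_add, map_add, h₁, h₂, map_add, embed_add]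
  | single z a =>
    rw [embed_single]
    simp only [Gate.apply, Finsupp.linearCombination_single, Gate.onKet,
      Finsupp.smul_single, embed_single, joinKet_liftQubit]

lemma toffoli_embed {Q Q' : Type} (O : Q → Ket → Ket) (O' : Q' → Ket → Ket) (c₁ c₂ t : Qubit)
    (w : Ket) (ψ : State) :
    (Gate.toffoli (liftQubit c₁) (liftQubit c₂) (liftQubit t) : Gate Q).apply O (embed w ψ) =
      embed w ((Gate.toffoli c₁ c₂ t : Gate Q').apply O' ψ) := by
  rw [toffoli_apply, toffoli_apply, embed, embed, ← Finsupp.mapDomain_comp,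
    ← Finsupp.mapDomain_comp]
  congr 1
  funext z
  simp only [Function.comp, toffoliMap, liftQubit_injective.eq_iff, joinKet_liftQubit]
  split_ifs
  · rfl
  · rw [joinKet_update]

/-! ### Coins from Hadamard gates -/

lemma hadamard_embed_aux {Q : Type} (O : Q → Ket → Ket) {u : Qubit} (hu : u.1 < 6) {w : Ket}
    (hw : w u = false) (ψ : State) : (Gate.hadamard u : Gate Q).apply O (embed w ψ) =
      (1 / (Real.sqrt 2 : ℂ)) • (embed (Function.update w u true) ψ +
        embed (Function.update w u false) ψ) := by
  induction ψ using Finsupp.induction_linear with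
  | zero => simp [embed_zero]
  | add ψ₁ ψ₂ h₁ h₂ =>
    rw [embed_add, map_add, h₁, h₂, ← smul_add, embed_add, embed_add]
    congr 1
    abel
  | single z a =>
    simp only [embed_single]
    simp only [Gate.apply, Finsupp.linearCombination_single, Gate.onKet, smul_add,
      Finsupp.smul_single, joinKet_of_lt _ _ hu, hw, update_joinKet _ _ hu, smul_eq_mul,
      Bool.false_eq_true, if_false, mul_comm]
    abel

lemma filter_embed (w : Ket) (ψ : State) {u : Qubit} (hu : u.1 < 6) (b : Bool) :
    (embed w ψ).filter (fun z => z u = b) = if w u = b then embed w ψ else 0 := by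
  rw [embed, filter_mapDomain]
  simp only [joinKet_of_lt _ _ hu]
  split_ifs with h
  · congr 1; ext z; simp [h]
  · rw [← Finsupp.mapDomain_zero (f := joinKet w)]
    congr 1; ext z; simp [h]

/-- A Hadamard gate on a fresh qubit is a coin toss. -/
lemma IsDecohered.hadamard {Q : Type} {U : Set Qubit} {E : State → ℝ} (hE : IsDecohered U E)
    (O : Q → Ket → Ket) {u : Qubit} (hu : u.1 < 6) (huU : u ∈ U) {w : Ket} (hw : w u = false)
    (ψ : State) : E ((Gate.hadamard u : Gate Q).apply O (embed w ψ)) =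
      𝔼 b : Bool, E (embed (Function.update w u b) ψ) := by
  have hs : ‖(1 / (Real.sqrt 2 : ℂ))‖ ^ 2 = 1 / 2 := by
    rw [norm_div, div_pow, Complex.norm_real]; simp
  -- The Hadamard gate produces a superposition of the two branches. Splitting along `u` removes the
  -- cross terms, and the squared amplitude is the probability of the coin.
  rw [hadamard_embed_aux O hu hw, hE.smul, hE.split u huU, Finsupp.filter_add, Finsupp.filter_add,
    filter_embed _ _ hu, filter_embed _ _ hu, filter_embed _ _ hu, filter_embed _ _ hu, hs,
    Fintype.expect_eq_sum_div_card, Fintype.sum_bool]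
  simp only [Function.update_self, if_true, Bool.false_eq_true, Bool.true_eq_false, if_false,
    add_zero, zero_add, Fintype.card_bool]
  push_cast
  ring

/-- Writing the string `v` into the array `a`, from position `s` on. -/
def Ket.writeAt {k : ℕ} (w : Ket) (a s : ℕ) (v : BitString k) : Ket := fun u =>
  if h : u.1 = a ∧ s ≤ u.2 ∧ u.2 < s + k then v ⟨u.2 - s, by omega⟩ else w u

lemma Ket.writeAt_apply {k : ℕ} (w : Ket) (a s : ℕ) (v : BitString k) (i : Fin k) :
    w.writeAt a s v (a, s + i) = v i := by
  simp [Ket.writeAt]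

lemma Ket.writeAt_cons {k : ℕ} (w : Ket) (a s : ℕ) (b : Bool) (v : BitString k) :
    w.writeAt a s (Fin.cons b v : BitString (k + 1)) =
      Ket.writeAt (Function.update w (a, s) b) a (s + 1) v := by
  funext ⟨x, i⟩
  simp only [Ket.writeAt]
  by_cases hx : x = a
  · subst hx
    rcases lt_trichotomy i s with h | h | h
    · rw [dif_neg (by omega), dif_neg (by omega), Function.update_of_ne (by simp; omega)]
    · subst h
      rw [dif_pos (by omega), dif_neg (by omega)]
      simp
    · by_cases h2 : i < s + (k + 1)
      · rw [dif_pos (by omega), dif_pos (by omega)]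
        have : (⟨i - s, by omega⟩ : Fin (k + 1)) = Fin.succ ⟨i - (s + 1), by omega⟩ := by
          ext; simp; omega
        rw [this, Fin.cons_succ]
      · rw [dif_neg (by omega), dif_neg (by omega), Function.update_of_ne (by simp; omega)]
  · rw [dif_neg (by simp [hx]), dif_neg (by simp [hx]), Function.update_of_ne (by simp [hx])]

/-- The gates `G x y, G (x + 1) (y + 1), …` of a loop. -/
def loopGates (G : ℕ → ℕ → Gate FunQuery) : ℕ → ℕ → ℕ → List (Gate FunQuery)
  | 0, _, _ => []
  | k + 1, x, y => G x y :: loopGates G k (x + 1) (y + 1)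

lemma mem_loopGates {G : ℕ → ℕ → Gate FunQuery} {k x y : ℕ} {g : Gate FunQuery}
    (h : g ∈ loopGates G k x y) : ∃ i < k, g = G (x + i) (y + i) := by
  induction k generalizing x y with
  | zero => simp [loopGates] at h
  | succ k ih =>
    rw [loopGates, List.mem_cons] at h
    rcases h with rfl | h
    · exact ⟨0, by omega, by simp⟩
    · obtain ⟨i, hi, rfl⟩ := ih h
      exact ⟨i + 1, by omega, by congr 1 <;> omega⟩

/-- Tossing `k` coins into the pool, the array `2`, from position `s` on. -/
def coinGates (k s : ℕ) : List (Gate FunQuery) := loopGates (fun x _ => .hadamard (2, x)) k s 0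

/-- Hadamard gates on distinct fresh qubits give independent coins, one qubit at a time. The counter
`y` plays no role here; it is general because the loop advances it together with the position. -/
lemma IsDecohered.coins {U : Set Qubit} {E : State → ℝ} (hE : IsDecohered U E)
    (f : BitString n → BitString n) {k s y : ℕ} (hU : ∀ i < k, (2, s + i) ∈ U) {w : Ket}
    (hw : ∀ i < k, w (2, s + i) = false) (ψ : State) :
    E (QCrypto.run (funOracle f) (loopGates (fun x _ => .hadamard (2, x)) k s y) (embed w ψ)) =
      𝔼 r : BitString k, E (embed (w.writeAt 2 s r) ψ) := by
  induction k generalizing s w y with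
  | zero =>
    have h : ∀ r : BitString 0, w.writeAt 2 s r = w := fun r => by
      funext u
      rw [Ket.writeAt, dif_neg (by omega)]
    simp [loopGates, h]
  | succ k ih =>
    -- The remaining tosses act on other positions, so the first coin stays decohered.
    have hfix : ∀ g ∈ loopGates (fun x _ => .hadamard (2, x)) k (s + 1) (y + 1),
        g.Fixes {(2, s)} := by
      intro g hg
      obtain ⟨i, -, rfl⟩ := mem_loopGates hg
      simp [Gate.Fixes]
      omega
    have h0 : ({(2, s)} : Set Qubit) ⊆ U := by
      rintro _ rfl
      exact hU 0 (by omega)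
    rw [loopGates, run_cons, ((hE.mono h0).run hfix f).hadamard (funOracle f) (by norm_num) rfl
      (hw 0 (by omega))]
    have h1 : ∀ b, E (QCrypto.run (funOracle f)
        (loopGates (fun x _ => .hadamard (2, x)) k (s + 1) (y + 1))
        (embed (Function.update w (2, s) b) ψ)) =
        𝔼 r : BitString k, E (embed (w.writeAt 2 s (Fin.cons b r : BitString (k + 1))) ψ) := by
      intro b
      rw [ih (s := s + 1)]
      · simp_rw [Ket.writeAt_cons]
      · intro i hi; have := hU (i + 1) (by omega); rwa [add_comm i 1, ← add_assoc] at this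
      · intro i hi
        rw [Function.update_of_ne (by simp; omega)]
        have := hw (i + 1) (by omega)
        rwa [add_comm i 1, ← add_assoc] at this
    simp_rw [h1]
    rw [← Fintype.expect_equiv (Fin.consEquiv fun _ : Fin (k + 1) => Bool)
      (fun p => E (embed (w.writeAt 2 s (Fin.cons p.1 p.2 : BitString (k + 1))) ψ)) _
      fun p => rfl]
    rw [← Finset.univ_product_univ, Finset.expect_product]

/-! ### Copying and evaluating -/

/-- Exclusive or of the string `v` into the array `a`, from position `s` on. -/
def Ket.xorAt {k : ℕ} (z : Ket) (a s : ℕ) (v : BitString k) : Ket := fun u =>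
  if h : u.1 = a ∧ s ≤ u.2 ∧ u.2 < s + k then Bool.xor (z u) (v ⟨u.2 - s, by omega⟩) else z u

lemma Ket.xorAt_xorAt {k : ℕ} (z : Ket) (a s : ℕ) (v v' : BitString k) :
    (z.xorAt a s v).xorAt a s v' = z.xorAt a s (bxor v v') := by
  funext u
  simp only [Ket.xorAt, bxor]
  split_ifs <;> simp

lemma bxor_self (v : BitString n) : bxor v v = fun _ => false := by
  funext i; simp [bxor]

lemma Ket.xorAt_false {k : ℕ} (z : Ket) (a s : ℕ) :
    z.xorAt a s (fun _ : Fin k => false) = z := by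
  funext u
  simp [Ket.xorAt]

lemma Ket.xorAt_self {k : ℕ} (z : Ket) (a s : ℕ) (v : BitString k) :
    (z.xorAt a s v).xorAt a s v = z := by
  rw [Ket.xorAt_xorAt, bxor_self, Ket.xorAt_false]

lemma Ket.xorAt_of_ne {k : ℕ} (z : Ket) {a : ℕ} (s : ℕ) (v : BitString k) {u : Qubit}
    (h : u.1 ≠ a) : z.xorAt a s v u = z u := by
  simp [Ket.xorAt, h]

lemma Ket.xorAt_zero_apply {k : ℕ} (z : Ket) (a : ℕ) (v : BitString k) (i : Fin k) :
    z.xorAt a 0 v (a, i) = Bool.xor (z (a, i)) (v i) := by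
  simp [Ket.xorAt]

lemma Ket.xorInto_eq_xorAt {k : ℕ} (z : Ket) (a : ℕ) (v : BitString k) :
    z.xorInto a v = z.xorAt a 0 v := by
  funext u
  simp [Ket.xorInto, Ket.xorAt]

lemma Ket.xorInto_append (z : Ket) (a : ℕ) (v v' : BitString n) :
    z.xorInto a (Fin.append v v' : BitString (n + n)) = (z.xorAt a 0 v).xorAt a n v' := by
  funext ⟨x, i⟩
  simp only [Ket.xorInto, Ket.xorAt]
  by_cases hx : x = a
  · rcases lt_or_ge i n with h | h
    · rw [dif_pos (by omega), dif_neg (by omega), dif_pos (by omega)]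
      congr 1
      exact Fin.append_left v v' ⟨i, h⟩
    · by_cases h2 : i < n + n
      · rw [dif_pos (by omega), dif_pos (by omega), dif_neg (by omega)]
        congr 1
        have : (⟨i, by omega⟩ : Fin (n + n)) = Fin.natAdd n ⟨i - n, by omega⟩ := by
          ext; simp; omega
        rw [this, Fin.append_right]
      · rw [dif_neg (by omega), dif_neg (by omega), dif_neg (by omega)]
  · simp [hx]

lemma joinKet_xorAt {k : ℕ} (w z : Ket) (a s : ℕ) (v : BitString k) :
    joinKet w (z.xorAt a s v) = (joinKet w z).xorAt (a + 6) s v := by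
  funext ⟨x, i⟩
  simp only [Ket.xorAt, joinKet]
  rcases lt_or_ge x 6 with h | h
  · simp [h, show x ≠ a + 6 by omega]
  · simp [show ¬ x < 6 by omega, show x - 6 = a ↔ x = a + 6 by omega]

lemma xorAt_joinKet {k : ℕ} (w z : Ket) {a : ℕ} (ha : a < 6) (s : ℕ) (v : BitString k) :
    (joinKet w z).xorAt a s v = joinKet (w.xorAt a s v) z := by
  funext ⟨x, i⟩
  simp only [Ket.xorAt, joinKet]
  by_cases h : x = a
  · subst h; simp [ha]
  · simp [h]

/-- Toffoli gates with controls `c (x + i)` and `(a, x + i)` and targets `(b, y + i)`. -/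
def toffoliGates (c : ℕ → Qubit) (a b k x y : ℕ) : List (Gate FunQuery) :=
  loopGates (fun x y => .toffoli (c x) (a, x) (b, y)) k x y

/-- Neither controls nor sources lie in the target array `b`, so earlier gates of the loop do not
affect what later ones read. -/
lemma run_toffoliGates (O : FunQuery → Ket → Ket) {c : ℕ → Qubit} {a b : ℕ} (hab : a ≠ b)
    (hc : ∀ i, (c i).1 ≠ b) (k x y : ℕ) (ψ : State) :
    run O (toffoliGates c a b k x y) ψ = ψ.mapDomain fun z => z.xorAt b y
      (fun i : Fin k => z (c (x + i)) && z (a, x + i)) := by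
  unfold toffoliGates
  induction k generalizing x y ψ with
  | zero =>
    have : (fun z : Ket => z.xorAt b y (fun i : Fin 0 => z (c (x + i)) && z (a, x + i))) = id := by
      funext z u
      rw [Ket.xorAt, dif_neg (by omega)]
      rfl
    rw [this, Finsupp.mapDomain_id]
    rfl
  | succ k ih =>
    rw [loopGates, run_cons, ih, toffoli_apply, ← Finsupp.mapDomain_comp]
    congr 1
    funext z ⟨j, i⟩
    have hne : ∀ u : Qubit, u.1 ≠ b → u ≠ (b, y) := by rintro u hu rfl; exact hu rfl
    have hcond : ¬ ((b, y) = c x ∨ (b, y) = (a, x)) := by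
      rintro (h | h)
      · exact hc x (by rw [← h])
      · exact hab (by simpa using congrArg Prod.fst h.symm)
    simp only [Function.comp, Ket.xorAt, toffoliMap, if_neg hcond,
      Function.update_of_ne (hne _ (hc _)), Function.update_of_ne (hne (a, _) hab)]
    by_cases hj : j = b
    · subst hj
      rcases lt_trichotomy i y with h | h | h
      · rw [dif_neg (by omega), dif_neg (by omega), Function.update_of_ne (by simp; omega)]
      · subst h
        rw [dif_neg (by omega), dif_pos (by omega)]
        simp
      · by_cases h2 : i < y + (k + 1)
        · rw [dif_pos (by omega), dif_pos (by omega), Function.update_of_ne (by simp; omega),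
            show x + 1 + (i - (y + 1)) = x + (i - y) by omega]
        · rw [dif_neg (by omega), dif_neg (by omega), Function.update_of_ne (by simp; omega)]
    · simp [hj]

/-- The circuit `L` applies `θ` to the adversary and takes the auxiliary qubits from `w` to `w'`. -/
def Carries (f : BitString n → BitString n) (L : List (Gate FunQuery)) (w w' : Ket)
    (θ : Ket → Ket) : Prop :=
  ∀ ψ, run (funOracle f) L (embed w ψ) = embed w' (ψ.mapDomain θ)

lemma Carries.append {f : BitString n → BitString n} {L L' : List (Gate FunQuery)}
    {w w' w'' : Ket} {θ θ' : Ket → Ket} (h : Carries f L w w' θ) (h' : Carries f L' w' w'' θ') :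
    Carries f (L ++ L') w w'' (θ' ∘ θ) := fun ψ => by
  rw [run_append, h, h', ← Finsupp.mapDomain_comp]

lemma carries_of_ket {f : BitString n → BitString n} {L : List (Gate FunQuery)} {w w' : Ket}
    {φ θ : Ket → Ket} (h : ∀ ψ, run (funOracle f) L ψ = ψ.mapDomain φ)
    (h' : ∀ z, φ (joinKet w z) = joinKet w' (θ z)) : Carries f L w w' θ := fun ψ => by
  rw [h, embed, embed, ← Finsupp.mapDomain_comp, ← Finsupp.mapDomain_comp]
  congr 1
  funext z
  exact h' z

/-- Controlled copying into an array of the adversary. -/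
lemma carries_toffoliGates_lift (f : BitString n → BitString n) {c : ℕ → Qubit} {a b : ℕ}
    (hab : a ≠ b + 6) (hc : ∀ i, (c i).1 ≠ b + 6) {k x y : ℕ} {w : Ket} (v : Ket → BitString k)
    (hv : ∀ z (i : Fin k), (joinKet w z (c (x + i)) && joinKet w z (a, x + i)) = v z i) :
    Carries f (toffoliGates c a (b + 6) k x y) w w fun z => z.xorAt b y (v z) := by
  refine carries_of_ket (run_toffoliGates _ hab hc k x y) fun z => ?_
  simp only [hv, joinKet_xorAt]

/-- Copying into an auxiliary array. -/
lemma carries_toffoliGates_aux (f : BitString n → BitString n) {c : ℕ → Qubit} {a b : ℕ}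
    (hb : b < 6) (hab : a ≠ b) (hc : ∀ i, (c i).1 ≠ b) {k x y : ℕ} {w : Ket} (v : BitString k)
    (hv : ∀ z (i : Fin k), (joinKet w z (c (x + i)) && joinKet w z (a, x + i)) = v i) :
    Carries f (toffoliGates c a b k x y) w (w.xorAt b y v) id := by
  refine carries_of_ket (run_toffoliGates _ hab hc k x y) fun z => ?_
  simp only [hv, xorAt_joinKet _ _ hb, id]

/-- Copying the array `a` into the array `b`. -/
def copyGates (a b k x y : ℕ) : List (Gate FunQuery) := toffoliGates (fun i => (a, i)) a b k x y

/-- Evaluating the function at the contents of the array `0`, into the array `1`. -/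
def evalGates : List (Gate FunQuery) := [.query (.eval 0 1)]

lemma carries_evalGates (f : BitString n → BitString n) {w : Ket} {v : BitString n}
    (hv : ∀ i : Fin n, w (0, i) = v i) : Carries f evalGates w (w.xorAt 1 0 (f v)) id := by
  refine carries_of_ket (φ := oracleMap f 0 1) (fun ψ => query_apply _ _ ψ) fun z => ?_
  have : (joinKet w z).read 0 n = v := by
    funext i
    rw [← hv i]
    exact joinKet_of_lt w z (by norm_num)
  simp only [oracleMap, zero_ne_one, if_false, this, Ket.xorInto_eq_xorAt, id,
    xorAt_joinKet w z (show 1 < 6 by norm_num)]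

/-- Encryption into the array `c`, where the randomness stands in the pool from position `s` on, and
`L` adds the message. -/
def encryptGates (n s c : ℕ) (L : List (Gate FunQuery)) : List (Gate FunQuery) :=
  copyGates 2 0 n s 0 ++ (evalGates ++ (copyGates 0 (c + 6) n 0 0 ++
    (copyGates 1 (c + 6) n 0 n ++ (L ++ (evalGates ++ copyGates 2 0 n s 0)))))

/-- The coin is copied to array `0`, `f` is evaluated into array `1`, and both are copied out. The
second evaluation and the second copy erase these scratch arrays, since exclusive or is its own
inverse and the pool still holds the coin. The message is added after array `c` has been written,
hence the requirement that `v` not depend on `c`. -/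
lemma carries_encryptGates (f : BitString n → BitString n) {s c : ℕ} {L : List (Gate FunQuery)}
    {w : Ket} {r : BitString n} {v : Ket → BitString n} (hr : ∀ i : Fin n, w (2, s + i) = r i)
    (h₀ : ∀ i : Fin n, w (0, i) = false) (h₁ : ∀ i : Fin n, w (1, i) = false)
    (hL : ∀ w', (∀ u, 2 ≤ u.1 → w' u = w u) → Carries f L w' w' fun z => z.xorAt c n (v z))
    (hv : ∀ z z' : Ket, (∀ u, u.1 ≠ c → z u = z' u) → v z = v z') :
    Carries f (encryptGates n s c L) w w fun z =>
      z.xorInto c (Fin.append r (bxor (f r) (v z)) : BitString (n + n)) := by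
  set w₁ := w.xorAt 0 0 r with hw₁
  set w₂ := w₁.xorAt 1 0 (f r) with hw₂
  have e₁ : ∀ i : Fin n, w₁ (0, i) = r i := fun i => by
    rw [hw₁, Ket.xorAt_zero_apply, h₀, Bool.false_xor]
  have e₁' : ∀ i : Fin n, w₁ (2, s + i) = r i := fun i => by
    rw [hw₁, Ket.xorAt_of_ne _ _ _ (by norm_num), hr]
  have e₂ : ∀ i : Fin n, w₂ (0, i) = r i := fun i => by
    rw [hw₂, Ket.xorAt_of_ne _ _ _ (by norm_num), e₁]
  have e₃ : ∀ i : Fin n, w₂ (1, i) = f r i := fun i => by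
    rw [hw₂, Ket.xorAt_zero_apply, hw₁, Ket.xorAt_of_ne _ _ _ (by norm_num), h₁, Bool.false_xor]
  have c₁ : Carries f (copyGates 2 0 n s 0) w w₁ id :=
    carries_toffoliGates_aux f (by norm_num) (by norm_num) (by simp) r fun z i => by
      rw [joinKet_of_lt _ _ (by norm_num), hr, Bool.and_self]
  have c₂ : Carries f evalGates w₁ w₂ id := carries_evalGates f e₁
  have c₃ : Carries f (copyGates 0 (c + 6) n 0 0) w₂ w₂ fun z => z.xorAt c 0 r :=
    carries_toffoliGates_lift f (by omega) (by simp) (fun _ => r) fun z i => by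
      rw [joinKet_of_lt _ _ (by norm_num), zero_add, e₂, Bool.and_self]
  have c₄ : Carries f (copyGates 1 (c + 6) n 0 n) w₂ w₂ fun z => z.xorAt c n (f r) :=
    carries_toffoliGates_lift f (by omega) (by simp) (fun _ => f r) fun z i => by
      rw [joinKet_of_lt _ _ (by norm_num), zero_add, e₃, Bool.and_self]
  have c₅ := hL w₂ fun u hu => by
    rw [hw₂, Ket.xorAt_of_ne _ _ _ (by omega), hw₁, Ket.xorAt_of_ne _ _ _ (by omega)]
  have c₆ : Carries f evalGates w₂ w₁ id := by
    have := carries_evalGates f e₂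
    rwa [hw₂, Ket.xorAt_self] at this
  have c₇ : Carries f (copyGates 2 0 n s 0) w₁ w id := by
    have : Carries f (copyGates 2 0 n s 0) w₁ (w₁.xorAt 0 0 r) id :=
      carries_toffoliGates_aux f (by norm_num) (by norm_num) (by simp) r fun z i => by
        rw [joinKet_of_lt _ _ (by norm_num), e₁', Bool.and_self]
    rwa [hw₁, Ket.xorAt_self] at this
  have key := c₁.append (c₂.append (c₃.append (c₄.append (c₅.append (c₆.append c₇)))))
  have e : (fun z : Ket => z.xorInto c (Fin.append r (bxor (f r) (v z)) : BitString (n + n))) =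
      id ∘ id ∘ (fun z => z.xorAt c n (v z)) ∘ (fun z => z.xorAt c n (f r)) ∘
        (fun z => z.xorAt c 0 r) ∘ id ∘ id := ?_
  · rw [e]; exact key
  funext z
  simp only [Function.comp, id]
  rw [Ket.xorInto_append, Ket.xorAt_xorAt]
  congr 2
  exact hv _ _ fun u hu => by rw [Ket.xorAt_of_ne _ _ _ hu, Ket.xorAt_of_ne _ _ _ hu]

/-! ### Simulation of the adversary -/

/-- The simulation of an encryption query. -/
def encGates (n s m c : ℕ) : List (Gate FunQuery) :=
  if m = c then [] else
    coinGates n s ++ encryptGates n s c (copyGates (m + 6) (c + 6) n 0 n)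

/-- The simulation of a decryption query. -/
def decGates (n c m : ℕ) : List (Gate FunQuery) :=
  if c = m then [] else
    .query (.eval (c + 6) (m + 6)) :: copyGates (c + 6) (m + 6) n n 0

/-- The simulation of a gate of the adversary, when `s` coins of the pool have been used. -/
def simGate {Q : Type} (n : ℕ) (ρ : Q → EncDecQuery) (s : ℕ) : Gate Q → List (Gate FunQuery)
  | .hadamard q => [.hadamard (liftQubit q)]
  | .phase q => [.phase (liftQubit q)]
  | .toffoli c₁ c₂ t => [.toffoli (liftQubit c₁) (liftQubit c₂) (liftQubit t)]
  | .query o => match ρ o with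
    | .enc m c => encGates n s m c
    | .dec c m => decGates n c m

/-- The number of coins reserved for a gate. -/
def coinUse {Q : Type} (n : ℕ) (ρ : Q → EncDecQuery) : Gate Q → ℕ
  | .query o => match ρ o with
    | .enc _ _ => n
    | .dec _ _ => 0
  | _ => 0

/-- The simulation of the adversary. -/
def simCircuit {Q : Type} (n : ℕ) (ρ : Q → EncDecQuery) : ℕ → List (Gate Q) → List (Gate FunQuery)
  | _, [] => []
  | s, g :: gs => simGate n ρ s g ++ simCircuit n ρ (s + coinUse n ρ g) gs

/-- The number of coins used after the simulation of a circuit. -/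
def simCounter {Q : Type} (n : ℕ) (ρ : Q → EncDecQuery) : ℕ → List (Gate Q) → ℕ
  | s, [] => s
  | s, g :: gs => simCounter n ρ (s + coinUse n ρ g) gs

lemma le_simCounter {Q : Type} (n : ℕ) (ρ : Q → EncDecQuery) (s : ℕ) (C : List (Gate Q)) :
    s ≤ simCounter n ρ s C := by
  induction C generalizing s with
  | nil => exact le_rfl
  | cons g gs ih => exact (Nat.le_add_right _ _).trans (ih _)

/-! ### Qubits left unchanged by the simulation -/

/-- The auxiliary qubits whose content is never changed once `s` coins have been used. -/
def fixedQubits (s : ℕ) : Set Qubit := {u | 2 ≤ u.1 ∧ u.1 < 6 ∧ (u.1 = 2 → u.2 < s)}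

lemma fixedQubits_mono {s s' : ℕ} (h : s ≤ s') : fixedQubits s ⊆ fixedQubits s' :=
  fun _ hu => ⟨hu.1, hu.2.1, fun h2 => (hu.2.2 h2).trans_le h⟩

lemma fixes_toffoliGates {U : Set Qubit} {c : ℕ → Qubit} {a b k x y : ℕ} (hb : ∀ i, (b, i) ∉ U) :
    ∀ g ∈ toffoliGates c a b k x y, g.Fixes U := by
  intro g hg
  obtain ⟨i, -, rfl⟩ := mem_loopGates hg
  exact hb _

lemma fixes_coinGates {U : Set Qubit} {k s : ℕ} (h : ∀ i, (2, s + i) ∉ U) :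
    ∀ g ∈ coinGates k s, g.Fixes U := by
  intro g hg
  obtain ⟨i, -, rfl⟩ := mem_loopGates hg
  exact h _

lemma fixes_append {U : Set Qubit} {L L' : List (Gate FunQuery)} (h : ∀ g ∈ L, g.Fixes U)
    (h' : ∀ g ∈ L', g.Fixes U) : ∀ g ∈ L ++ L', g.Fixes U := by
  intro g hg
  exact (List.mem_append.1 hg).elim (h g) (h' g)

lemma fixes_encryptGates {s c : ℕ} {L : List (Gate FunQuery)} {s' : ℕ}
    (hL : ∀ g ∈ L, g.Fixes (fixedQubits s')) :
    ∀ g ∈ encryptGates n s c L, g.Fixes (fixedQubits s') := by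
  have h0 : ∀ i, (0, i) ∉ fixedQubits s' := by simp [fixedQubits]
  have hc : ∀ i, (c + 6, i) ∉ fixedQubits s' := by simp [fixedQubits]
  have he : ∀ g ∈ evalGates, g.Fixes (fixedQubits s') := by
    simp [evalGates, Gate.Fixes, fixedQubits]
  exact fixes_append (fixes_toffoliGates h0) (fixes_append he
    (fixes_append (fixes_toffoliGates hc) (fixes_append (fixes_toffoliGates hc)
      (fixes_append hL (fixes_append he (fixes_toffoliGates h0))))))

lemma fixes_simGate {Q : Type} (ρ : Q → EncDecQuery) (s : ℕ) (g : Gate Q) :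
    ∀ g' ∈ simGate n ρ s g, g'.Fixes (fixedQubits s) := by
  have hlift : ∀ q, liftQubit q ∉ fixedQubits s := by simp [liftQubit, fixedQubits]
  have hc : ∀ c i, (c + 6, i) ∉ fixedQubits s := by simp [fixedQubits]
  cases g with
  | hadamard q => simpa [simGate, Gate.Fixes] using hlift q
  | phase q => simp [simGate, Gate.Fixes]
  | toffoli c₁ c₂ t => simpa [simGate, Gate.Fixes] using hlift t
  | query o =>
    simp only [simGate]
    cases ρ o with
    | enc m c =>
      simp only [encGates]
      split_ifs
      · simp
      · exact fixes_append (fixes_coinGates (by simp [fixedQubits]))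
          (fixes_encryptGates (fixes_toffoliGates (hc c)))
    | dec c m =>
      simp only [decGates]
      split_ifs
      · simp
      · intro g hg
        rcases List.mem_cons.1 hg with rfl | hg
        · exact Or.inr (hc m)
        · exact fixes_toffoliGates (hc m) g hg

lemma fixes_simCircuit {Q : Type} (ρ : Q → EncDecQuery) (s : ℕ) (C : List (Gate Q)) :
    ∀ g ∈ simCircuit n ρ s C, g.Fixes (fixedQubits s) := by
  induction C generalizing s with
  | nil => simp [simCircuit]
  | cons g gs ih =>
    exact fixes_append (fixes_simGate ρ s g)
      fun g' hg' => (ih _ g' hg').mono (fixedQubits_mono (Nat.le_add_right _ _))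

/-- The auxiliary qubits are as in `w₀`, up to `s` coins in the pool. -/
def AgreesOffPool (s : ℕ) (w₀ w : Ket) : Prop := ∀ u : Qubit, (u.1 = 2 ∧ u.2 < s) ∨ w u = w₀ u

lemma AgreesOffPool.mono {s s' : ℕ} {w₀ w : Ket} (h : AgreesOffPool s w₀ w) (hs : s ≤ s') :
    AgreesOffPool s' w₀ w :=
  fun u => (h u).imp_left fun h' => ⟨h'.1, h'.2.trans_le hs⟩

lemma AgreesOffPool.writeAt {s : ℕ} {w₀ w : Ket} (h : AgreesOffPool s w₀ w) (r : BitString n) :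
    AgreesOffPool (s + n) w₀ (w.writeAt 2 s r) := by
  intro u
  by_cases hu : u.1 = 2 ∧ u.2 < s + n
  · exact Or.inl hu
  · right
    rw [Ket.writeAt, dif_neg (by tauto)]
    exact (h u).resolve_left fun h' => hu ⟨h'.1, by omega⟩

lemma AgreesOffPool.pool {s : ℕ} {w₀ w : Ket} (h : AgreesOffPool s w₀ w)
    (hw₀ : ∀ u : Qubit, u.1 < 3 → w₀ u = false) (i : ℕ) : w (2, s + i) = false := by
  rw [(h (2, s + i)).resolve_left (by simp), hw₀ _ (by norm_num)]

lemma AgreesOffPool.eq_of_ne {s : ℕ} {w₀ w : Ket} (h : AgreesOffPool s w₀ w) {u : Qubit}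
    (hu : u.1 ≠ 2) : w u = w₀ u :=
  (h u).resolve_left fun h' => hu h'.1

/-- Here `E` stands for the value of everything after the query. Decoherence of the new pool qubits
turns the Hadamard gates into an average over `r`, and uncomputation returns all other auxiliary
qubits to their initial values. -/
lemma encGates_value {U : Set Qubit} {E : State → ℝ} (f : BitString n → BitString n) {s m c : ℕ}
    (hU : U ⊆ fixedQubits (s + n)) (hE : IsDecohered U E) (hs : ∀ i < n, (2, s + i) ∈ U)
    {w₀ w : Ket} (hw₀ : ∀ u : Qubit, u.1 < 3 → w₀ u = false) (hw : AgreesOffPool s w₀ w)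
    {κ : State → ℝ} (h : ∀ w, AgreesOffPool (s + n) w₀ w → ∀ ψ, E (embed w ψ) = κ ψ) (ψ : State) :
    E (run (funOracle f) (encGates n s m c) (embed w ψ)) =
      𝔼 r, κ (ψ.mapDomain (gameOracle f r (.enc m c))) := by
  unfold encGates
  split_ifs with hmc
  -- Coins are reserved even for this trivial query but not tossed; agreement off the pool does not
  -- notice this.
  · have : ∀ r, gameOracle f r (.enc m c) = id := fun r => by
      funext z; simp [gameOracle, oracleMap, hmc]
    simp only [this, Finsupp.mapDomain_id, Finset.expect_const Finset.univ_nonempty]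
    exact h w (hw.mono (by omega)) ψ
  · rw [run_append]
    have hfix : ∀ g ∈ encryptGates n s c (copyGates (m + 6) (c + 6) n 0 n), g.Fixes U :=
      fun g hg => (fixes_encryptGates (fixes_toffoliGates (by simp [fixedQubits])) g hg).mono hU
    rw [coinGates, (hE.run hfix f).coins f hs fun i _ => hw.pool hw₀ i]
    refine Finset.expect_congr rfl fun r _ => ?_
    have hw' := hw.writeAt r
    have hz : ∀ a, a < 2 → ∀ i : Fin n, w.writeAt 2 s r (a, i) = false := fun a ha i => by
      rw [hw'.eq_of_ne (by simp; omega), hw₀ _ (by simp; omega)]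
    have key := carries_encryptGates f (c := c) (L := copyGates (m + 6) (c + 6) n 0 n)
      (v := fun z => z.read m n)
      (fun i => Ket.writeAt_apply w 2 s r i) (hz 0 (by norm_num)) (hz 1 (by norm_num))
      (fun w' _ => carries_toffoliGates_lift f (by omega) (by simp; omega) _ fun z i => by
        rw [joinKet_add, Bool.and_self, zero_add]; rfl)
      (fun z z' hzz => by funext i; exact hzz _ hmc)
    rw [key ψ, h _ hw']
    congr 2
    funext z
    simp only [gameOracle, oracleMap, if_neg hmc, encFun]

/-- No scratch space is needed: `f` reads the first half of the ciphertext in place, and the second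
half is then added. Decryption uses no coin, so `r` is arbitrary. -/
lemma carries_decGates (f : BitString n → BitString n) (c m : ℕ) (w : Ket) (r : BitString n) :
    Carries f (decGates n c m) w w (gameOracle f r (.dec c m)) := by
  unfold decGates
  split_ifs with hcm
  · have : gameOracle f r (.dec c m) = id := by
      funext z; simp [gameOracle, oracleMap, hcm]
    intro ψ
    rw [this, Finsupp.mapDomain_id, run_nil]
  · have h₁ : Carries f [.query (.eval (c + 6) (m + 6))] w w fun z =>
        z.xorAt m 0 (f (z.read c n)) := by
      refine carries_of_ket (φ := oracleMap f (c + 6) (m + 6)) (fun ψ => query_apply _ _ ψ)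
        fun z => ?_
      have : (joinKet w z).read (c + 6) n = z.read c n := by
        funext i
        exact joinKet_add w z c i
      rw [oracleMap, if_neg (by omega), this, Ket.xorInto_eq_xorAt, joinKet_xorAt]
    have h₂ : Carries f (copyGates (c + 6) (m + 6) n n 0) w w fun z =>
        z.xorAt m 0 fun i : Fin n => z (c, n + i) :=
      carries_toffoliGates_lift f (by omega) (by simp; omega) _ fun z i => by
        rw [joinKet_add, Bool.and_self]
    have key := h₁.append h₂
    have e : gameOracle f r (.dec c m) = (fun z => z.xorAt m 0 fun i : Fin n => z (c, n + i)) ∘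
        fun z => z.xorAt m 0 (f (z.read c n)) := ?_
    · rw [e]; exact key
    funext z
    simp only [gameOracle, oracleMap, if_neg hcm, Function.comp, Ket.xorInto_eq_xorAt]
    rw [Ket.xorAt_xorAt]
    congr 1
    funext i
    simp only [decFun, bxor, Ket.read, Fin.val_natAdd, Fin.val_castAdd]
    rw [Ket.xorAt_of_ne _ _ _ (by simpa using hcm), Bool.xor_comm]
    rfl

/-- The simulation of the adversary is perfect. -/
theorem run_simCircuit {Q : Type} (ρ : Q → EncDecQuery) (f : BitString n → BitString n)
    {κ E : State → ℝ} {w₀ : Ket} (hw₀ : ∀ u : Qubit, u.1 < 3 → w₀ u = false) (C : List (Gate Q))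
    (s : ℕ) (hE : IsDecohered {u | u.1 = 2 ∧ u.2 < simCounter n ρ s C} E)
    (h : ∀ w, AgreesOffPool (simCounter n ρ s C) w₀ w → ∀ ψ, E (embed w ψ) = κ ψ)
    {w : Ket} (hw : AgreesOffPool s w₀ w) (ψ : State) :
    E (run (funOracle f) (simCircuit n ρ s C) (embed w ψ)) =
      expectRun (fun r o => gameOracle f r (ρ o)) κ C ψ := by
  induction C generalizing s w ψ with
  | nil => exact h w hw ψ
  | cons g gs ih =>
    simp only [simCircuit, simCounter, expectRun, run_append] at *
    have ih' := fun w hw ψ => ih (s + coinUse n ρ g) hE h (w := w) hw ψ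
    have hconst : ∀ x : ℝ, (𝔼 _r : BitString n, x) = x := fun x =>
      Finset.expect_const Finset.univ_nonempty x
    rcases g with q | q | ⟨c₁, c₂, t⟩ | o
    · have e : ∀ r, (Gate.hadamard q : Gate Q).apply (fun o => gameOracle f r (ρ o)) ψ =
          (Gate.hadamard q : Gate Q).apply (fun _ => id) ψ := fun r => rfl
      simp only [e, hconst]
      rw [← ih' w hw, simGate, run_cons, run_nil, hadamard_embed]
    · have e : ∀ r, (Gate.phase q : Gate Q).apply (fun o => gameOracle f r (ρ o)) ψ =
          (Gate.phase q : Gate Q).apply (fun _ => id) ψ := fun r => rfl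
      simp only [e, hconst]
      rw [← ih' w hw, simGate, run_cons, run_nil, phase_embed]
    · have e : ∀ r, (Gate.toffoli c₁ c₂ t : Gate Q).apply (fun o => gameOracle f r (ρ o)) ψ =
          (Gate.toffoli c₁ c₂ t : Gate Q).apply (fun _ => id) ψ := fun r => rfl
      simp only [e, hconst]
      rw [← ih' w hw, simGate, run_cons, run_nil, toffoli_embed]
    · simp only [query_apply]
      have hle := le_simCounter n ρ (s + coinUse n ρ (.query o)) gs
      -- The rest of the simulation never writes to coins already counted as used, so its value is
      -- decohered in them.
      have hfix : ∀ g ∈ simCircuit n ρ (s + coinUse n ρ (.query o)) gs,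
          g.Fixes {u | u.1 = 2 ∧ u.2 < s + coinUse n ρ (.query o)} := fun g hg =>
        (fixes_simCircuit ρ _ gs g hg).mono fun u hu => by
          simp only [Set.mem_ofPred_eq] at hu
          simp only [fixedQubits, Set.mem_ofPred_eq]
          omega
      have hE' := (hE.mono (V := {u | u.1 = 2 ∧ u.2 < s + coinUse n ρ (.query o)})
        fun u hu => ⟨hu.1, hu.2.trans_le hle⟩).run hfix f
      cases ho : ρ o with
      | enc m c =>
        have hcoin : coinUse n ρ (.query o) = n := by simp [coinUse, ho]
        rw [hcoin] at ih' hE'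
        have hg : simGate n ρ s (.query o) = encGates n s m c := by simp [simGate, ho]
        rw [hg, hcoin]
        exact encGates_value f (fun u hu => by
          simp only [Set.mem_ofPred_eq] at hu
          simp only [fixedQubits, Set.mem_ofPred_eq]
          omega) hE' (fun i hi => ⟨rfl, by simpa using hi⟩) hw₀ hw ih' ψ
      | dec c m =>
        have hcoin : coinUse n ρ (.query o) = 0 := by simp [coinUse, ho]
        rw [hcoin] at ih'
        have hg : simGate n ρ s (.query o) = decGates n c m := by simp [simGate, ho]
        rw [hg, hcoin]
        have e : ∀ r, gameOracle f r (.dec c m) = gameOracle f (fun _ => false) (.dec c m) :=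
          fun r => rfl
        simp only [e, hconst]
        rw [carries_decGates f c m w fun _ => false, ih' w hw]

/-! ### Simulation of the challenge -/

/-- Measuring an array of the adversary by copying it into an auxiliary array. -/
lemma IsDecohered.copyGates {U : Set Qubit} {E : State → ℝ} (hE : IsDecohered U E)
    (f : BitString n → BitString n) {a b : ℕ} (hb : b < 6) (hU : ∀ i, (b, i) ∈ U) {w : Ket}
    (hw : ∀ i, w (b, i) = false) (ψ : State) :
    E (QCrypto.run (funOracle f) (QCrypto.copyGates (a + 6) b n 0 0) (embed w ψ)) =
      ∑ m : BitString n, E (embed (w.xorAt b 0 m) (ψ.filter fun z => z.read a n = m)) := by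
  have hφ : ∀ ψ, QCrypto.run (funOracle f) (QCrypto.copyGates (a + 6) b n 0 0) (embed w ψ) =
      ψ.mapDomain fun z => joinKet (w.xorAt b 0 (z.read a n)) z := by
    intro ψ
    rw [QCrypto.copyGates, run_toffoliGates _ (by omega) (by simp; omega), embed,
      ← Finsupp.mapDomain_comp]
    congr 1
    funext z
    simp only [Function.comp, joinKet_add, Bool.and_self, xorAt_joinKet _ _ hb, zero_add]
    rfl
  -- Each copied qubit is in `U`, so the branches of different `m` do not interfere and the copy
  -- acts as a measurement.
  rw [hφ, hE.sum_filter (fun i : Fin n => (b, (i : ℕ))) fun i => hU i]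
  refine Finset.sum_congr rfl fun m _ => ?_
  congr 1
  rw [filter_mapDomain]
  have e : ∀ z : Ket, (fun i : Fin n => joinKet (w.xorAt b 0 (z.read a n)) z (b, i)) =
      z.read a n := fun z => by
    funext i
    rw [joinKet_of_lt _ _ hb, Ket.xorAt_zero_apply, hw, Bool.false_xor]
  simp only [e]
  refine Finsupp.mapDomain_congr fun z hz => ?_
  rw [Finsupp.support_filter, Finset.mem_filter] at hz
  rw [hz.2]

/-- Adding the message selected by the qubit `(3, 0)` to the challenge. -/
def selectGates (n : ℕ) : List (Gate FunQuery) :=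
  copyGates 5 (2 + 6) n 0 n ++ (toffoliGates (fun _ => (3, 0)) 4 (2 + 6) n 0 n ++
    toffoliGates (fun _ => (3, 0)) 5 (2 + 6) n 0 n)

/-- The measurement of the messages and the challenge, when `s` coins of the pool have been
used. -/
def challengeGates (n s : ℕ) : List (Gate FunQuery) :=
  copyGates (0 + 6) 4 n 0 0 ++ (copyGates (1 + 6) 5 n 0 0 ++
    (coinGates n s ++ encryptGates n s 2 (selectGates n)))

/-- With `β` the qubit `(3, 0)`, the gates add `m₁ ⊕ β m₀ ⊕ β m₁`, which is `m₁` for `β = 0` and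
`m₀` for `β = 1`. Hence the challenge bit is the negation of `β`. -/
lemma carries_selectGates (f : BitString n → BitString n) {w : Ket} {m₀ m₁ : BitString n}
    (h₀ : ∀ i : Fin n, w (4, i) = m₀ i) (h₁ : ∀ i : Fin n, w (5, i) = m₁ i) :
    Carries f (selectGates n) w w fun z =>
      z.xorAt 2 n (if !w (3, 0) then m₁ else m₀) := by
  have c₁ : Carries f (copyGates 5 (2 + 6) n 0 n) w w fun z => z.xorAt 2 n m₁ :=
    carries_toffoliGates_lift f (by norm_num) (by simp) (fun _ => m₁) fun z i => by
      rw [joinKet_of_lt _ _ (by norm_num), zero_add, h₁, Bool.and_self]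
  have c₂ : Carries f (toffoliGates (fun _ => (3, 0)) 4 (2 + 6) n 0 n) w w fun z =>
      z.xorAt 2 n fun i => w (3, 0) && m₀ i :=
    carries_toffoliGates_lift f (by norm_num) (by simp) (fun _ i => w (3, 0) && m₀ i) fun z i => by
      rw [joinKet_of_lt _ _ (by norm_num), joinKet_of_lt _ _ (by norm_num), zero_add, h₀]
  have c₃ : Carries f (toffoliGates (fun _ => (3, 0)) 5 (2 + 6) n 0 n) w w fun z =>
      z.xorAt 2 n fun i => w (3, 0) && m₁ i :=
    carries_toffoliGates_lift f (by norm_num) (by simp) (fun _ i => w (3, 0) && m₁ i) fun z i => by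
      rw [joinKet_of_lt _ _ (by norm_num), joinKet_of_lt _ _ (by norm_num), zero_add, h₁]
  have key := c₁.append (c₂.append c₃)
  have e : (fun z : Ket => z.xorAt 2 n (if !w (3, 0) then m₁ else m₀)) =
      ((fun z : Ket => z.xorAt 2 n fun i => w (3, 0) && m₁ i) ∘
        (fun z : Ket => z.xorAt 2 n fun i => w (3, 0) && m₀ i)) ∘
          fun z : Ket => z.xorAt 2 n m₁ := by
    funext z
    simp only [Function.comp, Ket.xorAt_xorAt]
    congr 1
    funext i
    cases w (3, 0) <;> cases h : m₀ i <;> cases h' : m₁ i <;> simp [bxor, h, h']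
  rw [e]
  exact key

lemma fixes_selectGates (s : ℕ) : ∀ g ∈ selectGates n, g.Fixes (fixedQubits s) :=
  fixes_append (fixes_toffoliGates (by simp [fixedQubits]))
    (fixes_append (fixes_toffoliGates (by simp [fixedQubits]))
      (fixes_toffoliGates (by simp [fixedQubits])))

lemma fixes_challengeGates {U : Set Qubit} {s : ℕ} (hU : U ⊆ fixedQubits s)
    (h4 : ∀ i, (4, i) ∉ U) (h5 : ∀ i, (5, i) ∉ U) : ∀ g ∈ challengeGates n s, g.Fixes U :=
  fixes_append (fixes_toffoliGates h4) (fixes_append (fixes_toffoliGates h5)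
    (fixes_append (fixes_coinGates fun i hi => by simpa [fixedQubits] using hU hi)
      fun g hg => (fixes_encryptGates (fixes_selectGates s) g hg).mono hU))

/-- The simulation of the challenge is perfect. -/
theorem run_challengeGates (f : BitString n → BitString n) {E : State → ℝ} {s : ℕ}
    (hE : IsDecohered (fixedQubits (s + n)) E) {κ : BitString (n + n) → State → ℝ} {w₀ : Ket}
    (hw₀ : ∀ u : Qubit, u.1 ≠ 3 → w₀ u = false)
    (h : ∀ m₀ m₁ : BitString n, ∀ w, AgreesOffPool (s + n) ((w₀.xorAt 4 0 m₀).xorAt 5 0 m₁) w →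
      ∀ v ψ, E (embed w (ψ.mapDomain fun z => z.xorInto 2 v)) = κ v ψ)
    {w : Ket} (hw : AgreesOffPool s w₀ w) (ψ : State) :
    E (run (funOracle f) (challengeGates n s) (embed w ψ)) =
      𝔼 r, ∑ m₀ : BitString n, ∑ m₁ : BitString n,
        κ (Fin.append r (bxor (f r) (if !w₀ (3, 0) then m₁ else m₀)))
          (ψ.filter fun z => z.read 0 n = m₀ ∧ z.read 1 n = m₁) := by
  have f₃ : ∀ g ∈ encryptGates n s 2 (selectGates n), g.Fixes (fixedQubits (s + n)) :=
    fixes_encryptGates (fixes_selectGates _)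
  have f₂ : ∀ g ∈ coinGates n s ++ encryptGates n s 2 (selectGates n),
      g.Fixes (fixedQubits s) :=
    fixes_append (fixes_coinGates (by simp [fixedQubits]))
      fun g hg => (f₃ g hg).mono (fixedQubits_mono (Nat.le_add_right _ _))
  have d₂ := (hE.mono (fixedQubits_mono (Nat.le_add_right s n))).run f₂ f
  have f₁ : ∀ g ∈ copyGates (1 + 6) 5 n 0 0, g.Fixes {u : Qubit | u.1 = 4} :=
    fixes_toffoliGates (by simp)
  -- Array `5` is still to be written when array `4` has just been filled, so decoherence at this
  -- point is claimed for array `4` only.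
  have d₁ := (d₂.mono (V := {u : Qubit | u.1 = 4}) fun u hu => by
    simp only [Set.mem_ofPred_eq] at hu
    simp only [fixedQubits, Set.mem_ofPred_eq]
    omega).run f₁ f
  simp only [challengeGates, run_append] at d₁ d₂ ⊢
  rw [d₁.copyGates f (b := 4) (by norm_num) (by simp) fun i => by
    rw [hw.eq_of_ne (by norm_num), hw₀ _ (by norm_num)]]
  rw [expect_sum_sum_comm]
  refine Finset.sum_congr rfl fun m₀ _ => ?_
  rw [d₂.copyGates f (b := 5) (by norm_num) (by simp [fixedQubits]) fun i => by
    rw [Ket.xorAt_of_ne _ _ _ (by norm_num), hw.eq_of_ne (by norm_num), hw₀ _ (by norm_num)]]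
  refine Finset.sum_congr rfl fun m₁ _ => ?_
  set w₁ := (w.xorAt 4 0 m₀).xorAt 5 0 m₁ with hw₁
  have hw' : AgreesOffPool s ((w₀.xorAt 4 0 m₀).xorAt 5 0 m₁) w₁ := fun u => by
    refine (hw u).imp_right fun hu => ?_
    simp only [hw₁, Ket.xorAt, hu]
  have hzero : ∀ u : Qubit, u.1 < 3 → ((w₀.xorAt 4 0 m₀).xorAt 5 0 m₁) u = false := fun u hu => by
    rw [Ket.xorAt_of_ne _ _ _ (by omega), Ket.xorAt_of_ne _ _ _ (by omega), hw₀ _ (by omega)]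
  have hfilter : ((ψ.filter fun z => z.read 0 n = m₀).filter fun z => z.read 1 n = m₁) =
      ψ.filter fun z => z.read 0 n = m₀ ∧ z.read 1 n = m₁ := by
    ext z
    simp only [Finsupp.filter_apply]
    split_ifs <;> simp_all
  rw [hfilter, coinGates, (hE.run f₃ f).coins f (by simp [fixedQubits]) fun i _ => hw'.pool hzero i]
  refine Finset.expect_congr rfl fun r _ => ?_
  have hr := hw'.writeAt r
  have hne : ∀ u : Qubit, u.1 ≠ 2 → w₁.writeAt 2 s r u = ((w₀.xorAt 4 0 m₀).xorAt 5 0 m₁) u :=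
    fun u hu => hr.eq_of_ne hu
  have h3 : w₁.writeAt 2 s r (3, 0) = w₀ (3, 0) := by
    rw [hne _ (by norm_num), Ket.xorAt_of_ne _ _ _ (by norm_num),
      Ket.xorAt_of_ne _ _ _ (by norm_num)]
  have h4 : ∀ i : Fin n, w₁.writeAt 2 s r (4, i) = m₀ i := fun i => by
    rw [hne _ (by norm_num), Ket.xorAt_of_ne _ _ _ (by norm_num), Ket.xorAt_zero_apply,
      hw₀ _ (by norm_num), Bool.false_xor]
  have h5 : ∀ i : Fin n, w₁.writeAt 2 s r (5, i) = m₁ i := fun i => by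
    rw [hne _ (by norm_num), Ket.xorAt_zero_apply, Ket.xorAt_of_ne _ _ _ (by norm_num),
      hw₀ _ (by norm_num), Bool.false_xor]
  have key := carries_encryptGates f (c := 2) (L := selectGates n)
    (v := fun _ => if !w₀ (3, 0) then m₁ else m₀)
    (fun i => Ket.writeAt_apply w₁ 2 s r i)
    (fun i => by rw [hne _ (by norm_num), hzero _ (by norm_num)])
    (fun i => by rw [hne _ (by norm_num), hzero _ (by norm_num)])
    (fun w' hw' => by
      have := carries_selectGates f (w := w') (m₀ := m₀) (m₁ := m₁)
        (fun i => by rw [hw' _ (by norm_num), h4]) (fun i => by rw [hw' _ (by norm_num), h5])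
      rwa [hw' _ (by norm_num), h3] at this)
    (fun _ _ _ => rfl)
  rw [key, h m₀ m₁ _ hr]

/-! ### The distinguisher -/

/-- The distinguisher that plays the game with a random challenge bit and accepts if the adversary
wins. -/
def distinguisher (n : ℕ) (C₁ : List (Gate EncDecQuery)) (C₂ : List (Gate EncQuery)) :
    List (Gate FunQuery) :=
  .hadamard (3, 0) :: (simCircuit n id 0 C₁ ++ (challengeGates n (simCounter n id 0 C₁) ++
    (simCircuit n EncQuery.toEncDec (simCounter n id 0 C₁ + n) C₂ ++
      [.toffoli (9, 0) (9, 0) (3, 0)])))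

/-- The last gate is a controlled NOT from `(9, 0)`, the adversary's output qubit shifted by `6`,
into the distinguisher's output qubit `(3, 0)`, which held the coin. -/
lemma outProb_run_final (f : BitString n → BitString n) (ψ : State) :
    outProb true (run (funOracle f) [.toffoli (9, 0) (9, 0) (3, 0)] ψ) =
      normSq (ψ.filter fun z => Bool.xor (z (3, 0)) (z (9, 0)) = true) := by
  rw [run_cons, run_nil, toffoli_apply, outProb, filter_mapDomain,
    normSq_mapDomain (toffoliMap_involutive _ _ _).injective]
  simp [toffoliMap, outQubit]

/-- Acceptance means that the adversary's output differs from the coin, that is, equals the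
challenge bit. -/
lemma normSq_filter_embed (w : Ket) (ψ : State) :
    normSq ((embed w ψ).filter fun z => Bool.xor (z (3, 0)) (z (9, 0)) = true) =
      outProb (!w (3, 0)) ψ := by
  rw [embed, filter_mapDomain, normSq_mapDomain (joinKet_injective w), outProb]
  have hxor : ∀ a b : Bool, Bool.xor a b = true ↔ b = !a := by decide
  congr 1
  ext z
  simp only [Finsupp.filter_apply, joinKet_of_lt w z (show (3, 0).1 < 6 by norm_num),
    joinKet_add w z 3 0, hxor]
  rfl

lemma embed_zeroState : embed (fun _ => false) zeroState = zeroState := by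
  rw [zeroState, embed_single]
  congr 1
  funext u
  simp [joinKet]

/-- The distinguisher accepts with the probability that the adversary wins. -/
theorem acceptProb_distinguisher (f : BitString n → BitString n) (C₁ : List (Gate EncDecQuery))
    (C₂ : List (Gate EncQuery)) :
    acceptProb (distinguisher n C₁ C₂) f = 𝔼 b : Bool, gameProb f C₁ C₂ b := by
  set s := simCounter n id 0 C₁ with hs
  let E₃ : State → ℝ := fun ψ =>
    normSq (ψ.filter fun z => Bool.xor (z (3, 0)) (z (9, 0)) = true)
  have d₃ : IsDecohered Set.univ E₃ := isDecohered_normSq_filter _ _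
  let E₂ : State → ℝ := fun ψ =>
    E₃ (run (funOracle f) (simCircuit n EncQuery.toEncDec (s + n) C₂) ψ)
  have d₂ : IsDecohered (fixedQubits (s + n)) E₂ :=
    (d₃.mono (Set.subset_univ _)).run (fixes_simCircuit _ _ _) f
  let E₁ : State → ℝ := fun ψ => E₂ (run (funOracle f) (challengeGates n s) ψ)
  -- Arrays `4` and `5` are excluded because the challenge writes to them.
  have d₁ : IsDecohered {u | (u.1 = 2 ∧ u.2 < s) ∨ u = (3, 0)} E₁ := by
    have hsub : {u : Qubit | (u.1 = 2 ∧ u.2 < s) ∨ u = (3, 0)} ⊆ fixedQubits s := by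
      rintro u (hu | rfl) <;> simp [fixedQubits]
      omega
    exact (d₂.mono (hsub.trans (fixedQubits_mono (Nat.le_add_right _ _)))).run
      (fixes_challengeGates hsub (by simp) (by simp)) f
  let E₀ : State → ℝ := fun ψ => E₁ (run (funOracle f) (simCircuit n id 0 C₁) ψ)
  have d₀ : IsDecohered {(3, 0)} E₀ :=
    (d₁.mono (by simp)).run (fun g hg => (fixes_simCircuit _ _ _ g hg).mono
      (by simp [fixedQubits])) f
  have h₀ : acceptProb (distinguisher n C₁ C₂) f =
      E₀ ((Gate.hadamard (3, 0) : Gate FunQuery).apply (funOracle f)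
        (embed (fun _ => false) zeroState)) := by
    rw [acceptProb, expectRun_unit, distinguisher, run_cons, run_append, run_append, run_append,
      outProb_run_final, embed_zeroState]
  rw [h₀, d₀.hadamard (funOracle f) (by norm_num) rfl rfl]
  -- The coin `β` corresponds to the challenge bit `!β`, so the two averages are matched by
  -- negation.
  have hnot : Function.Involutive Bool.not := Bool.not_not
  refine Fintype.expect_equiv hnot.toPerm _ _ fun β => ?_
  set w₀ : Ket := Function.update (fun _ => false) (3, 0) β with hw₀
  have hw₀' : ∀ u : Qubit, u.1 ≠ 3 → w₀ u = false := fun u hu => by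
    rw [hw₀, Function.update_of_ne (by rintro rfl; exact hu rfl)]
  have hβ : w₀ (3, 0) = β := by simp [hw₀]
  change E₀ (embed w₀ zeroState) = gameProb f C₁ C₂ (!β)
  refine run_simCircuit id f (w₀ := w₀) (fun u hu => hw₀' u (by omega)) C₁ 0
    (d₁.mono fun u hu => Or.inl hu) (fun w hw ψ => ?_) (fun u => Or.inr rfl) zeroState
  have := run_challengeGates f d₂ (κ := phaseTwoProb f C₂ (!β)) hw₀' (fun m₀ m₁ w hw v ψ => ?_)
    hw ψ
  · rw [hβ] at this
    exact this
  · refine run_simCircuit EncQuery.toEncDec f (fun u hu => ?_) C₂ (s + n)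
      (d₃.mono (Set.subset_univ _)) (fun w' hw' φ => ?_) hw _
    · rw [Ket.xorAt_of_ne _ _ _ (by omega), Ket.xorAt_of_ne _ _ _ (by omega), hw₀' _ (by omega)]
    · rw [← hβ, ← Ket.xorAt_of_ne w₀ 0 m₀ (show (3, 0).1 ≠ 4 by norm_num),
        ← Ket.xorAt_of_ne (w₀.xorAt 4 0 m₀) 0 m₁ (show (3, 0).1 ≠ 5 by norm_num),
        ← hw'.eq_of_ne (by norm_num)]
      exact normSq_filter_embed w' φ

/-! ### The program of the distinguisher

The variables `0`, …, `6` of the distinguisher hold the security parameter, the constants one and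
zero, the number of used coins and three loop counters. Its variable `x + 7` is the variable `x` of
the adversary. -/

/-- Every step emits at most one gate, so the running time bounds the number of queries. -/
lemma Exec.length_le {Q : Type} {P : Prog Q} {μ μ' : Mem} {C : List (Gate Q)} {t : ℕ}
    (h : Exec P μ C μ' t) : C.length ≤ t := by
  induction h <;> try simp
  all_goals omega

/-- The contents of the registers of the distinguisher. -/
def regValue (n s : ℕ) : ℕ → ℕ
  | 0 => n
  | 1 => 1
  | 2 => 0
  | _ => s

/-- The memory `ν` of the distinguisher represents the memory `μ` of the adversary and the number
`s` of used coins. -/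
structure SimMem (n s : ℕ) (μ ν : Mem) : Prop where
  var : ∀ x, ν.var (x + 7) = μ.var x
  arr : ν.arr = μ.arr
  reg : ∀ x < 4, ν.var x = regValue n s x

lemma SimMem.set_counter {n s : ℕ} {μ ν : Mem} (h : SimMem n s μ ν) {x : ℕ} (hx : 4 ≤ x)
    (hx' : x < 7) (v : ℕ) : SimMem n s μ (ν.set x v) where
  var y := by
    simp only [Mem.set]
    rw [Function.update_of_ne (by omega), h.var]
  arr := h.arr
  reg y hy := by
    simp only [Mem.set]
    rw [Function.update_of_ne (by omega), h.reg y hy]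

lemma SimMem.set {n s : ℕ} {μ ν : Mem} (h : SimMem n s μ ν) (x v : ℕ) :
    SimMem n s (μ.set x v) (ν.set (x + 7) v) where
  var y := by
    simp only [Mem.set]
    by_cases hy : y = x
    · subst hy; simp
    · rw [Function.update_of_ne (by omega), Function.update_of_ne hy, h.var]
  arr := h.arr
  reg y hy := by
    simp only [Mem.set]
    rw [Function.update_of_ne (by omega), h.reg y hy]

lemma SimMem.setArr {n s : ℕ} {μ ν : Mem} (h : SimMem n s μ ν) (a i v : ℕ) :
    SimMem n s (μ.setArr a i v) (ν.setArr a i v) where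
  var := h.var
  arr := by simp only [Mem.setArr, h.arr]
  reg := h.reg

/-- In at most `T` steps, `P` emits `L` and takes a memory that represents `μ` and `s` to one that
represents `μ'` and `s'`. -/
def Emits (n : ℕ) (P : Prog FunQuery) (s : ℕ) (μ : Mem) (L : List (Gate FunQuery)) (s' : ℕ)
    (μ' : Mem) (T : ℕ) : Prop :=
  ∀ ν, SimMem n s μ ν → ∃ ν' t, Exec P ν L ν' t ∧ t ≤ T ∧ SimMem n s' μ' ν'

variable {s s' s'' T T' : ℕ} {μ μ' μ'' : Mem} {P P' : Prog FunQuery} {L L' : List (Gate FunQuery)}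

lemma Emits.seq (h : Emits n P s μ L s' μ' T) (h' : Emits n P' s' μ' L' s'' μ'' T') :
    Emits n (.seq P P') s μ (L ++ L') s'' μ'' (T + T') := by
  intro ν hν
  obtain ⟨ν', t, he, ht, hν'⟩ := h ν hν
  obtain ⟨ν'', t', he', ht', hν''⟩ := h' ν' hν'
  exact ⟨ν'', t + t', he.seq he', by omega, hν''⟩

lemma Emits.mono (h : Emits n P s μ L s' μ' T) (hT : T ≤ T') (hL : L = L') :
    Emits n P s μ L' s' μ' T' := by
  subst hL
  intro ν hν
  obtain ⟨ν', t, he, ht, hν'⟩ := h ν hν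
  exact ⟨ν', t, he, ht.trans hT, hν'⟩

/-- A loop of length `n` that emits one gate per round, with two counters that start from the values
of `x` and `y`. -/
def gateLoop (body : Prog FunQuery) (x y : ℕ) : Prog FunQuery :=
  .seq (.add 5 x 2) (.seq (.add 6 y 2) (.seq (.add 4 0 2) (.while 4
    (.seq body (.seq (.add 5 5 1) (.seq (.add 6 6 1) (.sub 4 4 1)))))))

/-- A round takes five steps: the gate, two increments, a decrement and the loop test. The extra
step is the final test. -/
lemma exec_gateLoop_while {body : Prog FunQuery} {G : ℕ → ℕ → Gate FunQuery}
    (hbody : ∀ ν : Mem, ν.var 2 = 0 → Exec body ν [G (ν.var 5) (ν.var 6)] ν 1)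
    (k : ℕ) {ν : Mem} (hν : SimMem n s μ ν) (hk : ν.var 4 = k) :
    ∃ ν', Exec (.while 4 (.seq body (.seq (.add 5 5 1) (.seq (.add 6 6 1) (.sub 4 4 1))))) ν
      (loopGates G k (ν.var 5) (ν.var 6)) ν' (5 * k + 1) ∧ SimMem n s μ ν' := by
  induction k generalizing ν with
  | zero => exact ⟨ν, .while_zero hk, hν⟩
  | succ k ih =>
    have h₁ : ν.var 1 = 1 := hν.reg 1 (by norm_num)
    have h₂ : ν.var 2 = 0 := hν.reg 2 (by norm_num)
    set ν₁ := ν.set 5 (ν.var 5 + ν.var 1) with hν₁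
    set ν₂ := ν₁.set 6 (ν₁.var 6 + ν₁.var 1) with hν₂
    set ν₃ := ν₂.set 4 (ν₂.var 4 - ν₂.var 1) with hν₃
    have hs : SimMem n s μ ν₃ := ((hν.set_counter (by norm_num) (by norm_num) _).set_counter
      (by norm_num) (by norm_num) _).set_counter (by norm_num) (by norm_num) _
    have e4 : ν₃.var 4 = k := by simp [hν₃, hν₂, hν₁, Mem.set, hk, h₁]
    have e5 : ν₃.var 5 = ν.var 5 + 1 := by simp [hν₃, hν₂, hν₁, Mem.set, h₁]
    have e6 : ν₃.var 6 = ν.var 6 + 1 := by simp [hν₃, hν₂, hν₁, Mem.set, h₁]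
    obtain ⟨ν', he, hν'⟩ := ih hs e4
    rw [e5, e6] at he
    refine ⟨ν', ?_, hν'⟩
    have hloop := Exec.while_pos (x := 4) (by omega) ((hbody ν h₂).seq ((Exec.add ν 5 5 1).seq
      ((Exec.add ν₁ 6 6 1).seq (Exec.sub ν₂ 4 4 1)))) he
    rw [show 5 * (k + 1) + 1 = 1 + (1 + (1 + 1)) + (5 * k + 1) + 1 by omega]
    exact hloop

lemma emits_gateLoop {body : Prog FunQuery} {G : ℕ → ℕ → Gate FunQuery}
    (hbody : ∀ ν : Mem, ν.var 2 = 0 → Exec body ν [G (ν.var 5) (ν.var 6)] ν 1)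
    {x y : ℕ} (hx : x < 4) (hy : y < 4) :
    Emits n (gateLoop body x y) s μ (loopGates G n (regValue n s x) (regValue n s y)) s μ
      (5 * n + 4) := by
  intro ν hν
  have h₂ : ν.var 2 = 0 := hν.reg 2 (by norm_num)
  have h₀ : ν.var 0 = n := hν.reg 0 (by norm_num)
  set ν₁ := ν.set 5 (ν.var x + ν.var 2) with hν₁
  set ν₂ := ν₁.set 6 (ν₁.var y + ν₁.var 2) with hν₂
  set ν₃ := ν₂.set 4 (ν₂.var 0 + ν₂.var 2) with hν₃
  have hs₁ : SimMem n s μ ν₁ := hν.set_counter (by norm_num) (by norm_num) _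
  have hs₂ : SimMem n s μ ν₂ := hs₁.set_counter (by norm_num) (by norm_num) _
  have hs₃ : SimMem n s μ ν₃ := hs₂.set_counter (by norm_num) (by norm_num) _
  have e4 : ν₃.var 4 = n := by simp [hν₃, hν₂, hν₁, Mem.set, h₀, h₂]
  have e5 : ν₃.var 5 = regValue n s x := by
    rw [← hν.reg x hx]; simp [hν₃, hν₂, hν₁, Mem.set, h₂]
  have e6 : ν₃.var 6 = regValue n s y := by
    rw [← hs₁.reg y hy]; simp [hν₃, hν₂, hν₁, Mem.set, h₂]
  obtain ⟨ν', he, hν'⟩ := exec_gateLoop_while hbody n hs₃ e4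
  rw [e5, e6] at he
  exact ⟨ν', _, (Exec.add ν 5 x 2).seq ((Exec.add ν₁ 6 y 2).seq ((Exec.add ν₂ 4 0 2).seq he)),
    by omega, hν'⟩

/-- The program for `copyGates`. -/
def copyProg (a x b y : ℕ) : Prog FunQuery := gateLoop (.toffoli a 5 a 5 b 6) x y

lemma emits_copyProg (a b : ℕ) {x y : ℕ} (hx : x < 4) (hy : y < 4) :
    Emits n (copyProg a x b y) s μ (copyGates a b n (regValue n s x) (regValue n s y)) s μ
      (5 * n + 4) :=
  emits_gateLoop (fun ν _ => Exec.toffoli ν a 5 a 5 b 6) hx hy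

/-- The program for controlled copying. -/
def controlledCopyProg (a x b y : ℕ) : Prog FunQuery := gateLoop (.toffoli 3 2 a 5 b 6) x y

lemma emits_controlledCopyProg (a b : ℕ) {x y : ℕ} (hx : x < 4) (hy : y < 4) :
    Emits n (controlledCopyProg a x b y) s μ
      (toffoliGates (fun _ => (3, 0)) a b n (regValue n s x) (regValue n s y)) s μ (5 * n + 4) :=
  emits_gateLoop (fun ν h => by simpa only [h] using Exec.toffoli (Q := FunQuery) ν 3 2 a 5 b 6)
    hx hy

/-- The program for `coinGates`. -/
def coinProg : Prog FunQuery := gateLoop (.hadamard 2 5) 3 2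

lemma emits_coinProg : Emits n coinProg s μ (coinGates n s) s μ (5 * n + 4) :=
  emits_gateLoop (fun ν _ => Exec.hadamard ν 2 5) (by norm_num) (by norm_num)

lemma emits_evalGates : Emits n (.query (.eval 0 1)) s μ evalGates s μ 1 :=
  fun ν hν => ⟨ν, 1, .query ν _, le_rfl, hν⟩

/-- Counting `n` used coins. -/
def countProg : Prog FunQuery := .add 3 3 0

lemma emits_countProg : Emits n countProg s μ [] (s + n) μ 1 := by
  intro ν hν
  refine ⟨_, 1, .add ν 3 3 0, le_rfl, fun x => ?_, hν.arr, fun x hx => ?_⟩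
  · simp only [Mem.set]
    rw [Function.update_of_ne (by omega), hν.var]
  · have h₀ : ν.var 0 = n := hν.reg 0 (by norm_num)
    have h₃ : ν.var 3 = s := hν.reg 3 (by norm_num)
    simp only [Mem.set]
    by_cases h : x = 3
    · subst h; simp [h₀, h₃, regValue]
    · rw [Function.update_of_ne h, hν.reg x hx]
      interval_cases x <;> first | rfl | exact absurd rfl h

/-- The program for `encryptGates`. -/
def encryptProg (c : ℕ) (P : Prog FunQuery) : Prog FunQuery :=
  .seq (copyProg 2 3 0 2) (.seq (.query (.eval 0 1)) (.seq (copyProg 0 2 (c + 6) 2)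
    (.seq (copyProg 1 2 (c + 6) 0) (.seq P (.seq (.query (.eval 0 1)) (copyProg 2 3 0 2))))))

lemma emits_encryptProg (c : ℕ) (h : Emits n P s μ L s μ T) :
    Emits n (encryptProg c P) s μ (encryptGates n s c L) s μ (T + 20 * n + 18) :=
  ((emits_copyProg 2 0 (by norm_num) (by norm_num)).seq (emits_evalGates.seq
    ((emits_copyProg 0 (c + 6) (by norm_num) (by norm_num)).seq
      ((emits_copyProg 1 (c + 6) (by norm_num) (by norm_num)).seq (h.seq (emits_evalGates.seq
        (emits_copyProg 2 0 (by norm_num) (by norm_num)))))))).mono (by omega) rfl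

/-- The program for `encGates`. -/
def encProg (m c : ℕ) : Prog FunQuery :=
  if m = c then countProg else
    .seq (.seq coinProg (encryptProg c (copyProg (m + 6) 2 (c + 6) 0))) countProg

/-- Six loops of `5 * n + 4` steps, two evaluations and one update of the coin counter. -/
lemma emits_encProg (m c : ℕ) :
    Emits n (encProg m c) s μ (encGates n s m c) (s + n) μ (30 * n + 27) := by
  unfold encProg encGates
  split_ifs
  · exact emits_countProg.mono (by omega) rfl
  · exact ((emits_coinProg.seq (emits_encryptProg c (emits_copyProg (m + 6) (c + 6) (by norm_num)
      (by norm_num)))).seq emits_countProg).mono (by omega) (List.append_nil _)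

/-- The program for `decGates`. -/
def decProg (c m : ℕ) : Prog FunQuery :=
  if c = m then .skip else .seq (.query (.eval (c + 6) (m + 6))) (copyProg (c + 6) 0 (m + 6) 2)

/-- The bound is that of `emits_encProg` on purpose, so that one factor serves for every step of the
adversary's program. -/
lemma emits_decProg (c m : ℕ) :
    Emits n (decProg c m) s μ (decGates n c m) s μ (30 * n + 27) := by
  unfold decProg decGates
  split_ifs
  · exact fun ν hν => ⟨ν, 1, .skip ν, by omega, hν⟩
  · have h : Emits n (.query (.eval (c + 6) (m + 6))) s μ [.query (.eval (c + 6) (m + 6))] s μ 1 :=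
      fun ν hν => ⟨ν, 1, .query ν _, le_rfl, hν⟩
    exact (h.seq (emits_copyProg (c + 6) (m + 6) (x := 0) (y := 2) (by norm_num)
      (by norm_num))).mono (by omega) rfl

/-- The program for `challengeGates`. -/
def challengeProg : Prog FunQuery :=
  .seq (.seq (copyProg (0 + 6) 2 4 2) (.seq (copyProg (1 + 6) 2 5 2) (.seq coinProg (encryptProg 2
    (.seq (copyProg 5 2 (2 + 6) 0) (.seq (controlledCopyProg 4 2 (2 + 6) 0)
      (controlledCopyProg 5 2 (2 + 6) 0))))))) countProg

lemma emits_challengeProg :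
    Emits n challengeProg s μ (challengeGates n s) (s + n) μ (50 * n + 43) :=
  (((emits_copyProg (0 + 6) 4 (by norm_num) (by norm_num)).seq
    ((emits_copyProg (1 + 6) 5 (by norm_num) (by norm_num)).seq (emits_coinProg.seq
      (emits_encryptProg 2 ((emits_copyProg 5 (2 + 6) (by norm_num) (by norm_num)).seq
        ((emits_controlledCopyProg 4 (2 + 6) (by norm_num) (by norm_num)).seq
          (emits_controlledCopyProg 5 (2 + 6) (by norm_num) (by norm_num)))))))).seq
            emits_countProg).mono (by omega) (List.append_nil _)

/-- The program that simulates the adversary. -/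
def simProg {Q : Type} (ρ : Q → EncDecQuery) : Prog Q → Prog FunQuery
  | .skip => .skip
  | .const x c => .const (x + 7) c
  | .add x y z => .add (x + 7) (y + 7) (z + 7)
  | .sub x y z => .sub (x + 7) (y + 7) (z + 7)
  | .load x a y => .load (x + 7) a (y + 7)
  | .store a x y => .store a (x + 7) (y + 7)
  | .hadamard a x => .hadamard (a + 6) (x + 7)
  | .phase a x => .phase (a + 6) (x + 7)
  | .toffoli a x b y c z => .toffoli (a + 6) (x + 7) (b + 6) (y + 7) (c + 6) (z + 7)
  | .query o => match ρ o with
    | .enc m c => encProg m c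
    | .dec c m => decProg c m
  | .seq P P' => .seq (simProg ρ P) (simProg ρ P')
  | .ifZero x P P' => .ifZero (x + 7) (simProg ρ P) (simProg ρ P')
  | .while x P => .while (x + 7) (simProg ρ P)

lemma simCircuit_append {Q : Type} (ρ : Q → EncDecQuery) (s : ℕ) (C C' : List (Gate Q)) :
    simCircuit n ρ s (C ++ C') =
      simCircuit n ρ s C ++ simCircuit n ρ (simCounter n ρ s C) C' := by
  induction C generalizing s with
  | nil => rfl
  | cons g gs ih => simp [simCircuit, simCounter, ih]

lemma simCounter_append {Q : Type} (ρ : Q → EncDecQuery) (s : ℕ) (C C' : List (Gate Q)) :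
    simCounter n ρ s (C ++ C') = simCounter n ρ (simCounter n ρ s C) C' := by
  induction C generalizing s with
  | nil => rfl
  | cons g gs ih => simp [simCounter, ih]

/-- The simulation of a program. -/
theorem emits_simProg {Q : Type} (ρ : Q → EncDecQuery) {P : Prog Q} {μ μ' : Mem}
    {C : List (Gate Q)} {t : ℕ} (h : Exec P μ C μ' t) (s : ℕ) :
    Emits n (simProg ρ P) s μ (simCircuit n ρ s C) (simCounter n ρ s C) μ'
      (t * (30 * n + 27)) := by
  induction h generalizing s with
  | skip μ => exact fun ν hν => ⟨ν, 1, .skip ν, by omega, hν⟩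
  | const μ x c => exact fun ν hν => ⟨_, 1, .const ν (x + 7) c, by omega, hν.set x c⟩
  | add μ x y z =>
    refine fun ν hν => ⟨_, 1, .add ν (x + 7) (y + 7) (z + 7), by omega, ?_⟩
    rw [hν.var, hν.var]
    exact hν.set _ _
  | sub μ x y z =>
    refine fun ν hν => ⟨_, 1, .sub ν (x + 7) (y + 7) (z + 7), by omega, ?_⟩
    rw [hν.var, hν.var]
    exact hν.set _ _
  | load μ x a y =>
    refine fun ν hν => ⟨_, 1, .load ν (x + 7) a (y + 7), by omega, ?_⟩
    rw [hν.var, hν.arr]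
    exact hν.set _ _
  | store μ a x y =>
    refine fun ν hν => ⟨_, 1, .store ν a (x + 7) (y + 7), by omega, ?_⟩
    rw [hν.var, hν.var]
    exact hν.setArr _ _ _
  | hadamard μ a x =>
    refine fun ν hν => ⟨ν, 1, ?_, by omega, hν⟩
    have := Exec.hadamard (Q := FunQuery) ν (a + 6) (x + 7)
    rwa [hν.var] at this
  | phase μ a x =>
    refine fun ν hν => ⟨ν, 1, ?_, by omega, hν⟩
    have := Exec.phase (Q := FunQuery) ν (a + 6) (x + 7)
    rwa [hν.var] at this
  | toffoli μ a x b y c z =>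
    refine fun ν hν => ⟨ν, 1, ?_, by omega, hν⟩
    have := Exec.toffoli (Q := FunQuery) ν (a + 6) (x + 7) (b + 6) (y + 7) (c + 6) (z + 7)
    rwa [hν.var, hν.var, hν.var] at this
  | query μ o =>
    simp only [simProg, simCircuit, simCounter, simGate, coinUse, List.append_nil, one_mul]
    cases ρ o with
    | enc m c => exact emits_encProg m c
    | dec c m => exact emits_decProg c m
  | seq _ _ ih ih' =>
    rw [simCircuit_append, simCounter_append, add_mul]
    exact (ih s).seq (ih' _)
  | ifZero_zero hx _ ih =>
    intro ν hν
    obtain ⟨ν', t, he, ht, hν'⟩ := ih s ν hν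
    exact ⟨ν', t + 1, .ifZero_zero ((hν.var _).trans hx) he, by rw [add_mul]; omega, hν'⟩
  | ifZero_pos hx _ ih =>
    intro ν hν
    obtain ⟨ν', t, he, ht, hν'⟩ := ih s ν hν
    exact ⟨ν', t + 1, .ifZero_pos (by rwa [hν.var]) he, by rw [add_mul]; omega, hν'⟩
  | while_zero hx =>
    exact fun ν hν => ⟨ν, 1, .while_zero ((hν.var _).trans hx), by omega, hν⟩
  | while_pos hx _ _ ih ih' =>
    intro ν hν
    obtain ⟨ν', t, he, ht, hν'⟩ := ih s ν hν
    obtain ⟨ν'', t', he', ht', hν''⟩ := ih' _ ν' hν'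
    rw [simCircuit_append, simCounter_append]
    exact ⟨ν'', t + t' + 1, .while_pos (by rwa [hν.var]) he he', by
      rw [add_mul, add_mul]; omega, hν''⟩

/-- The distinguisher runs in polynomial time. -/
theorem isQPT_distinguisher {C₁ : ℕ → List (Gate EncDecQuery)} {C₂ : ℕ → List (Gate EncQuery)}
    (h : IsQPTTwoPhase C₁ C₂) : IsQPT fun n => distinguisher n (C₁ n) (C₂ n) := by
  obtain ⟨P₁, P₂, p, hp⟩ := h
  -- The two assignments set the constant-one register and copy `n` into variable `7`, the
  -- adversary's variable `0`. In the bound, `47` is `43` from `emits_challengeProg` plus these two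
  -- steps, the initial Hadamard gate and the final Toffoli gate.
  refine ⟨.seq (.const 1 1) (.seq (.add 7 0 2) (.seq (.hadamard 3 2) (.seq (simProg id P₁)
    (.seq challengeProg (.seq (simProg EncQuery.toEncDec P₂) (.toffoli 9 2 9 2 3 2)))))),
    p * (30 * Polynomial.X + 27) + 50 * Polynomial.X + 47, fun n => ?_⟩
  obtain ⟨μ₁, μ₂, t₁, t₂, h₁, h₂, ht⟩ := hp n
  set ν₁ := (Mem.init n).set 1 1 with hν₁
  set ν₂ := ν₁.set 7 (ν₁.var 0 + ν₁.var 2) with hν₂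
  have hs : SimMem n 0 (Mem.init n) ν₂ := by
    refine ⟨fun x => ?_, rfl, fun x hx => ?_⟩
    · simp only [hν₂, hν₁, Mem.set, Mem.init]
      rcases Nat.eq_zero_or_pos x with rfl | hx
      · simp
      · rw [Function.update_of_ne (by omega), Function.update_of_ne (by omega)]
        simp [hx.ne']
    · simp only [hν₂, hν₁, Mem.set, Mem.init]
      interval_cases x <;> simp [regValue]
  have hfinal : ∀ s, Emits n (.toffoli 9 2 9 2 3 2) s μ₂ [.toffoli (9, 0) (9, 0) (3, 0)] s μ₂ 1 :=
    fun s ν hν => ⟨ν, 1, by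
      have := Exec.toffoli (Q := FunQuery) ν 9 2 9 2 3 2
      rwa [show ν.var 2 = 0 from hν.reg 2 (by norm_num)] at this, le_rfl, hν⟩
  obtain ⟨ν', t, he, ht', -⟩ := ((emits_simProg id h₁ 0).seq (emits_challengeProg.seq
    ((emits_simProg EncQuery.toEncDec h₂ _).seq (hfinal _)))) ν₂ hs
  have hhad := Exec.hadamard (Q := FunQuery) ν₂ 3 2
  rw [show ν₂.var 2 = 0 from hs.reg 2 (by norm_num)] at hhad
  refine ⟨ν', _, (Exec.const (Mem.init n) 1 1).seq ((Exec.add ν₁ 7 0 2).seq (hhad.seq he)), ?_⟩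
  have hmul := Nat.mul_le_mul_right (30 * n + 27) ht
  rw [add_mul] at hmul
  simp only [Polynomial.eval_add, Polynomial.eval_mul, Polynomial.eval_X, Polynomial.eval_ofNat]
  omega

/-! ### Negligible functions -/

lemma tendsto_polynomial_mul_pow (q : Polynomial ℝ) {r : ℝ} (hr : 0 ≤ r) (hr' : r < 1) :
    Filter.Tendsto (fun n : ℕ => q.eval (n : ℝ) * r ^ n) Filter.atTop (nhds 0) := by
  induction q using Polynomial.induction_on' with
  | add p q hp hq =>
    have := hp.add hq
    rw [add_zero] at this
    refine this.congr fun n => ?_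
    rw [Polynomial.eval_add, add_mul]
  | monomial k a =>
    have := (tendsto_pow_const_mul_const_pow_of_lt_one k hr hr').const_mul a
    rw [mul_zero] at this
    refine this.congr fun n => ?_
    rw [Polynomial.eval_monomial, mul_assoc]

lemma negligible_polynomial_mul_pow (q : Polynomial ℝ) {r : ℝ} (hr : 0 ≤ r) (hr' : r < 1) :
    Negligible fun n => q.eval (n : ℝ) * r ^ n := by
  intro p hp
  obtain ⟨N, hN⟩ := Filter.eventually_atTop.1
    ((tendsto_polynomial_mul_pow (q * p) hr hr').eventually_lt_const one_pos)
  refine ⟨N, fun n hn => ?_⟩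
  have := hN n hn.le
  rw [Polynomial.eval_mul] at this
  rw [lt_div_iff₀ (hp n)]
  linarith

lemma Negligible.add {ε ε' : ℕ → ℝ} (h : Negligible ε) (h' : Negligible ε') :
    Negligible fun n => ε n + ε' n := by
  intro p hp
  -- Negligibility is applied to `2 * p`, so that two errors below `1 / (2 p)` add up to less than
  -- `1 / p`.
  have h2 : ∀ n : ℕ, 0 < (2 * p).eval (n : ℝ) := fun n => by
    rw [Polynomial.eval_mul, Polynomial.eval_ofNat]
    exact mul_pos two_pos (hp n)
  obtain ⟨N, hN⟩ := h _ h2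
  obtain ⟨N', hN'⟩ := h' _ h2
  refine ⟨max N N', fun n hn => ?_⟩
  have e₁ := hN n ((le_max_left _ _).trans_lt hn)
  have e₂ := hN' n ((le_max_right _ _).trans_lt hn)
  have e₃ : 1 / p.eval (n : ℝ) = 1 / (2 * p).eval (n : ℝ) + 1 / (2 * p).eval (n : ℝ) := by
    have := (hp n).ne'
    rw [Polynomial.eval_mul, Polynomial.eval_ofNat]
    field_simp
    norm_num
  linarith

/-! ### Security -/

/-- Exactness of the simulation, averaged over the uniform key. -/
lemma winProb_prfScheme (F : ∀ n, BitString n → BitString n → BitString n) (n : ℕ)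
    (C₁ : List (Gate EncDecQuery)) (C₂ : List (Gate EncQuery)) :
    winProb (prfScheme F) n C₁ C₂ =
      𝔼 k : BitString n, acceptProb (distinguisher n C₁ C₂) (F n k) := by
  simp_rw [acceptProb_distinguisher, ← guessProb_prfScheme]
  have hk : ∀ k : BitString n, ((prfScheme F).keyGen n k).toReal =
      (Fintype.card (BitString n) : ℝ)⁻¹ := fun k => by
    change ((PMF.uniformOfFintype (BitString n)) k).toReal = _
    rw [PMF.uniformOfFintype_apply, ENNReal.toReal_inv, ENNReal.toReal_natCast]
  rw [Fintype.expect_eq_sum_div_card, Finset.sum_div]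
  refine Finset.sum_congr rfl fun k _ => ?_
  exact (congrArg (· * _) (hk k)).trans (div_eq_inv_mul _ _).symm

/-- With a uniformly random function, few gates give a small advantage. -/
lemma expect_acceptProb_distinguisher_le {n T : ℕ} {C₁ : List (Gate EncDecQuery)}
    {C₂ : List (Gate EncQuery)} (hT : C₁.length + C₂.length ≤ T) :
    𝔼 f : BitString n → BitString n, acceptProb (distinguisher n C₁ C₂) f ≤
      1 / 2 + 9 * T * (Real.sqrt 2)⁻¹ ^ n := by
  have hr : 0 < (Real.sqrt 2)⁻¹ := by positivity
  have hr1 : (Real.sqrt 2)⁻¹ ≤ 1 := inv_le_one_of_one_le₀ (Real.one_le_sqrt.2 (by norm_num))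
  -- With `t = 2^(-n/2)` the two error terms `t` and `t⁻¹ * 4 / 2 ^ n` are of the same order; since
  -- `t * t ≤ t`, the cost per gate is at most `9 * t`.
  set t := (Real.sqrt 2)⁻¹ ^ n with ht
  have ht0 : 0 < t := pow_pos hr n
  have ht1 : t ≤ 1 := pow_le_one₀ hr.le hr1
  have htt : (2 : ℝ) ^ n = (t * t)⁻¹ := by
    rw [ht, ← mul_pow, ← mul_inv, Real.mul_self_sqrt (by norm_num), inv_pow, inv_inv]
  simp_rw [acceptProb_distinguisher]
  refine (expect_gameProb_le C₁ C₂ ht0).trans ?_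
  have e₁ : (1 + t⁻¹) * (4 / 2 ^ n) = 4 * (t * t) + 4 * t := by
    rw [htt]
    field_simp
  have e₂ : (C₂.length : ℝ) / 2 ^ n = C₂.length * (t * t) := by
    rw [htt, div_inv_eq_mul]
  have e₃ : t * t ≤ t := mul_le_of_le_one_left ht0.le ht1
  have hT' : (C₁.length : ℝ) + C₂.length ≤ T := by exact_mod_cast hT
  rw [e₁, e₂]
  have b₁ : (C₁.length : ℝ) * (t + (4 * (t * t) + 4 * t)) ≤ C₁.length * (9 * t) := by
    gcongr
    linarith
  have b₂ : (C₂.length : ℝ) * (t * t) ≤ C₂.length * (9 * t) := by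
    gcongr
    linarith
  have b₃ := mul_le_mul_of_nonneg_right hT' (by positivity : 0 ≤ 9 * t)
  linarith

end QCrypto

end

theorem mainTheorem1
    (F : ∀ n : ℕ, QCrypto.BitString n → QCrypto.BitString n → QCrypto.BitString n)
    (hF : QCrypto.IsQPRF F) :
    QCrypto.IsINDQCCA1 (QCrypto.prfScheme F) := by
  intro C₁ C₂ hC
  obtain ⟨ε, hε, h⟩ := hF _ (QCrypto.isQPT_distinguisher hC)
  obtain ⟨P₁, P₂, p, hp⟩ := hC
  have hr1 : (Real.sqrt 2)⁻¹ < 1 :=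
    inv_lt_one_of_one_lt₀ ((Real.lt_sqrt zero_le_one).2 (by norm_num))
  -- The advantage is the distinguishing advantage plus the error for a random function, a
  -- polynomial times `2^(-n/2)`.
  refine ⟨_, hε.add (QCrypto.negligible_polynomial_mul_pow
    (9 * p.map (Nat.castRingHom ℝ)) (by positivity) hr1), fun n => ?_⟩
  have hlen : (C₁ n).length + (C₂ n).length ≤ p.eval n := by
    obtain ⟨μ₁, μ₂, t₁, t₂, h₁, h₂, ht⟩ := hp n
    have := h₁.length_le
    have := h₂.length_le
    omega
  have e₁ := QCrypto.expect_acceptProb_distinguisher_le (n := n) hlen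
  have e₂ := (abs_le.1 (h n)).2
  rw [QCrypto.winProb_prfScheme, Polynomial.eval_mul, Polynomial.eval_ofNat,
    Polynomial.eval_natCast_map]
  simp only [eq_natCast, Nat.cast_id]
  linarith
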